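/- Let $H$ be a real Hilbert space with inner product $\langle\cdot,\cdot\rangle$ and norm $\|\cdot\|$, and let $X$ (the space "$H^2$") be a real Banach space that is densely, injectively and compactly embedded in $H$. Let $V,W:X\to\mathbb R$ be functionals whose Fréchet derivatives are represented in $H$, $DV(u)v=\langle V'(u),v\rangle$ and $DW(u)v=\langle W'(u),v\rangle$, with $V':X\to H$ of class $C^1$ (so $V$ is $C^2$) and $W':X\to H$ continuous (so $W$ is $C^1$). Let $\Phi=\{\psi\in X: V'(\psi)=0\}$, and assume that for every $\psi\in\Phi$ the operator $V''(\psi):X\to H$ is Fredholm of index zero. Say that branching occurs at $\psi\in\Phi$ if $\psi$ is not isolated in $\Phi$ (in the topology of $X$), and assume $({\bf H_R})$: if branching occurs at $\psi\in\Phi$ and $k=\dim\ker V''(\psi)\ge 1$, then in a neighbourhood of $\psi$ the set $\Phi$ is an embedded $k$-dimensional $C^1$ submanifold of $X$. Call $h:[0,\infty)\to\mathbb R$ a *slow rate* if $h\in C^2$, $h>0$ and $h'<0$ on $[0,\infty)$, $h(t)\to0$ as $t\to\infty$, $\sqrt h\in L^1(\mathbb R_+)$ and $h'(t)/h(t)\to0$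 as $t\to\infty$. Then $h(t)=(1+t)^{-\alpha}$ is a slow rate for every $\alpha>2$, and the following holds for every slow rate $h$. Let $u:[0,\infty)\to X$ be an orbit of $$u_t=V'(u)+h(t)W'(u)\qquad(t>0),$$ that is, $u\in C((0,\infty);X)\cap C([0,\infty);H)$, and $u$ is differentiable in $H$ and satisfies the equation for all $t>0$. Suppose that the orbit is bounded in the following sense: either (a) $\{u(t):t\ge0\}$ is relatively compact in $X$, or (b) $\{u(t):t\ge0\}$ is bounded in $X$, $V$ and $W'$ are bounded on bounded subsets of $X$, and $V'$ is coercive on bounded sets: every bounded sequence $(v_n)$ in $X$ with $V'(v_n)\to0$ in $H$ has a subsequence that converges in $X$. Let $\omega(u)$ be the set of limits in $H$ of sequences $u(t_n)$ with $t_n\to\infty$. Then: 1. $\omega(u)\subseteq\Phi$; 2. there is $\psi\in\Phi$ with $\omega(u)=\{\psi\}$, and $u(t)\to\psi$ in $H$ as $t\to\infty$; 3. if branching occurs at this limit $\psi$, or if $\ker V''(\psi)=\{0\}$ (that is, unless $\psi$ is an isolated equilibrium with a non-trivial kernel), there is a constant $C$ such that $$\|u(t)-\psi\|\le C\int_{t-1}^{\infty}\sqrt{h(s)}\,ds\qquad\text{for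 all }t\ge1.$$ -/

import Mathlib

open Set Filter Topology MeasureTheory

namespace PerturbedGradient

section Rates

/-- The class of decay rates `h` on `[0, ∞)`: `h` is of class `C²`, positive, strictly decreasing
(`h' < 0`) to `0`, `√h` is integrable on `ℝ₊`, and the decay is slow: `h'(t) / h(t) → 0`. -/
structure IsSlowDecay (h : ℝ → ℝ) : Prop where
  contDiffOn : ContDiffOn ℝ 2 h (Ici 0)
  pos : ∀ t, 0 ≤ t → 0 < h t
  deriv_neg : ∀ t, 0 ≤ t → derivWithin h (Ici 0) t < 0
  tendsto_zero : Tendsto h atTop (𝓝 0)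
  integrable_sqrt : IntegrableOn (fun t => Real.sqrt (h t)) (Ici 0)
  slow : Tendsto (fun t => derivWithin h (Ici 0) t / h t) atTop (𝓝 0)

end Rates

section Systems

variable {H X : Type*} [NormedAddCommGroup H] [InnerProductSpace ℝ H]
  [NormedAddCommGroup X] [NormedSpace ℝ X]

/-- `G : X → H` is the Fréchet derivative of `V : X → ℝ`, represented through the inner product
of the larger space `H`, i.e. `DV(u) v = ⟪G u, j v⟫` for the embedding `j : X → H`. -/
def IsGradient (j : X →L[ℝ] H) (V : X → ℝ) (G : X → H) : Prop :=
  ∀ u, HasFDerivAt V ((innerSL ℝ (G u)).comp j) u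

/-- The set `Φ` of equilibria of `u_t = G u`. -/
def equilibria (G : X → H) : Set X := {ψ | G ψ = 0}

/-- A Fredholm operator of index zero. -/
def IsFredholmIndexZero (A : X →L[ℝ] H) : Prop :=
  A.IsFredholm ∧ Module.finrank ℝ A.ker = Module.finrank ℝ (H ⧸ A.range)

/-- Branching of equilibria occurs at `ψ`: it is a non-isolated point of the set of equilibria. -/
def IsBranchingPoint (G : X → H) (ψ : X) : Prop :=
  G ψ = 0 ∧ AccPt ψ (𝓟 (equilibria G))

/-- In a neighbourhood of `ψ`, the set `S` is an embedded `k`-dimensional `C¹` submanifold of `X`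
through `ψ`: a relatively open piece of `S` around `ψ` is the image of an open subset of `ℝᵏ`
under a `C¹` immersion that is a homeomorphism onto this image. -/
def IsLocalManifoldAt (k : ℕ) (S : Set X) (ψ : X) : Prop :=
  ∃ (O : Set X) (U : Set (EuclideanSpace ℝ (Fin k))) (φ : EuclideanSpace ℝ (Fin k) → X),
    IsOpen O ∧ ψ ∈ O ∧ IsOpen U ∧ ContDiffOn ℝ 1 φ U ∧
    (∀ μ ∈ U, Function.Injective (fderiv ℝ φ μ)) ∧
    IsEmbedding (U.domRestrict φ) ∧ φ '' U = S ∩ O ∧ ψ ∈ φ '' U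

/-- The resonance hypothesis: if branching occurs at an equilibrium `ψ` whose linearization
has a kernel of dimension `k ≥ 1`, then the set of equilibria is, near `ψ`,
a `k`-dimensional manifold. -/
def ResonanceHypothesis (G : X → H) : Prop :=
  ∀ ψ, IsBranchingPoint G ψ → 1 ≤ Module.finrank ℝ (fderiv ℝ G ψ).ker →
    IsLocalManifoldAt (Module.finrank ℝ (fderiv ℝ G ψ).ker) (equilibria G) ψ

/-- `u` is an orbit of `u_t = G u + h(t) K u`, `t > 0`: it is continuous with values in `X`
for `t > 0`, continuous with values in `H` up to `t = 0`, and it satisfies the equation in `H`. -/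
structure IsOrbit (j : X →L[ℝ] H) (G K : X → H) (h : ℝ → ℝ) (u : ℝ → X) : Prop where
  continuousOn : ContinuousOn u (Ioi 0)
  continuousOn_zero : ContinuousOn (fun t => j (u t)) (Ici 0)
  equation : ∀ t, 0 < t → HasDerivAt (fun s => j (u s)) (G (u t) + h t • K (u t)) t

/-- The `ω`-limit set of `u` in the topology of `H`. -/
def omegaLimitSet (j : X →L[ℝ] H) (u : ℝ → X) : Set H :=
  {y | ∃ s : ℕ → ℝ, Tendsto s atTop atTop ∧ Tendsto (fun n => j (u (s n))) atTop (𝓝 y)}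

/-- `f` maps bounded sets to bounded sets. -/
def BoundedOnBounded {E F : Type*} [Bornology E] [Bornology F] (f : E → F) : Prop :=
  ∀ B : Set E, Bornology.IsBounded B → Bornology.IsBounded (f '' B)

/-- Coercivity (compactness) of `G` on bounded sets: every `X`-bounded sequence along which
`G → 0` in `H` has a subsequence that converges in `X`. -/
def IsCoerciveOnBounded (G : X → H) : Prop :=
  ∀ v : ℕ → X, Bornology.IsBounded (range v) → Tendsto (fun n => G (v n)) atTop (𝓝 0) →
    ∃ (x : X) (n : ℕ → ℕ), StrictMono n ∧ Tendsto (fun i => v (n i)) atTop (𝓝 x)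

end Systems

end PerturbedGradient

/-!
The energy `e = V ψ - V(u) + h (M - W(u))` satisfies `e' ≤ -‖(j u)'‖²` along an orbit, so that `u`
spends late times near states with small gradient; the Palais–Smale condition turns these into
equilibria. At an equilibrium `ψ` that is non-degenerate or lies on a manifold of equilibria
tangent to `ker V''(ψ)`, the restriction of `V''(ψ)` to a complement of its kernel is bounded below,
whence the Łojasiewicz inequality `|V - V ψ| ≤ C ‖V'‖²`. It makes the length of the orbit after
time `t` at most a multiple of `∫ₜ^∞ √h + √(e t)`, and `√e = O(√h)` by comparison. If the
limit point `ψ` is an isolated equilibrium, the orbit eventually avoids every small sphere around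
`ψ` and is thereby trapped inside.
-/

namespace PerturbedGradient

/-! ### Decay rates -/

theorem derivWithin_one_add_rpow (β : ℝ) {t : ℝ} (ht : 0 ≤ t) :
    derivWithin (fun t : ℝ => (1 + t) ^ β) (Ici 0) t = β * (1 + t) ^ (β - 1) := by
  have hd := ((hasDerivAt_id t).const_add 1).rpow_const (p := β)
    (Or.inl (by rw [id_eq]; positivity))
  simpa using hd.hasDerivWithinAt.derivWithin (uniqueDiffOn_Ici (0 : ℝ) t ht)

theorem integrableOn_sqrt_one_add_rpow {β : ℝ} (hβ : β < -2) :
    IntegrableOn (fun t : ℝ => √((1 + t) ^ β)) (Ici 0) := by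
  rw [integrableOn_Ici_iff_integrableOn_Ioi]
  refine (integrableOn_add_rpow_Ioi_of_lt (a := β / 2) (m := 1) (by linarith)
    (by norm_num)).congr_fun (fun t (ht : 0 < t) => ?_) measurableSet_Ioi
  simp only [Real.sqrt_eq_rpow]
  rw [← Real.rpow_mul (by positivity), add_comm, mul_one_div]

theorem isSlowDecay_rpow {α : ℝ} (hα : 2 < α) : IsSlowDecay (fun t => (1 + t) ^ (-α)) where
  contDiffOn := ContDiffOn.rpow_const_of_ne (by fun_prop) fun t (ht : 0 ≤ t) => by positivity
  pos t ht := by positivity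
  deriv_neg t ht := by
    rw [derivWithin_one_add_rpow _ ht]
    exact mul_neg_of_neg_of_pos (by linarith) (by positivity)
  tendsto_zero := (tendsto_rpow_neg_atTop (by linarith)).comp (tendsto_atTop_add_const_left _ 1
    tendsto_id)
  integrable_sqrt := integrableOn_sqrt_one_add_rpow (by linarith)
  slow := by
    have hlim : Tendsto (fun t : ℝ => -α * (1 + t)⁻¹) atTop (𝓝 0) := by
      simpa using (tendsto_inv_atTop_zero.comp
        (tendsto_atTop_add_const_left _ (1 : ℝ) tendsto_id)).const_mul (-α)
    refine hlim.congr' ?_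
    filter_upwards [eventually_ge_atTop 0] with t ht
    rw [derivWithin_one_add_rpow _ ht, Real.rpow_sub_one (by positivity)]
    field_simp

/-- The class of rates `h` for which all orbits of the perturbed gradient flow converge: `h` is
positive and nonincreasing on `[0, ∞)`, differentiable on `(0, ∞)`, and `√h` is integrable. -/
structure IsDecayRate (h : ℝ → ℝ) : Prop where
  differentiableOn : DifferentiableOn ℝ h (Ioi 0)
  pos : ∀ t, 0 ≤ t → 0 < h t
  antitoneOn : AntitoneOn h (Ici 0)
  integrableOn_sqrt : IntegrableOn (fun t => √(h t)) (Ioi 0)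

section Rates

variable {h : ℝ → ℝ}

theorem IsSlowDecay.hasDerivAt (hh : IsSlowDecay h) {t : ℝ} (ht : 0 < t) :
    HasDerivAt h (derivWithin h (Ici 0) t) t :=
  (hh.contDiffOn.differentiableOn (by norm_num) t ht.le).hasDerivWithinAt.hasDerivAt
    (Ici_mem_nhds ht)

theorem IsSlowDecay.isDecayRate (hh : IsSlowDecay h) : IsDecayRate h where
  differentiableOn t ht := (hh.hasDerivAt ht).differentiableAt.differentiableWithinAt
  pos := hh.pos
  antitoneOn := by
    refine antitoneOn_of_deriv_nonpos (convex_Ici 0) hh.contDiffOn.continuousOn ?_ ?_ <;>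
      rw [interior_Ici]
    · exact fun t ht => (hh.hasDerivAt ht).differentiableAt.differentiableWithinAt
    · exact fun t ht => (hh.hasDerivAt ht).deriv.trans_le (hh.deriv_neg t (le_of_lt ht)).le
  integrableOn_sqrt := hh.integrable_sqrt.mono_set Ioi_subset_Ici_self

theorem IsSlowDecay.tendsto_logDeriv (hh : IsSlowDecay h) :
    Tendsto (logDeriv h) atTop (𝓝 0) := by
  refine hh.slow.congr' ?_
  filter_upwards [eventually_gt_atTop 0] with t ht
  rw [logDeriv_apply, (hh.hasDerivAt ht).deriv]

/-- The tail integral `∫ₜ^∞ √h`, in terms of which the convergence of orbits is measured. -/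
noncomputable def sqrtTail (h : ℝ → ℝ) (t : ℝ) : ℝ := ∫ s in Ioi t, √(h s)

theorem sqrtTail_nonneg (h : ℝ → ℝ) (t : ℝ) : 0 ≤ sqrtTail h t :=
  integral_nonneg fun _ => Real.sqrt_nonneg _

theorem tendsto_sqrtTail (h : ℝ → ℝ) : Tendsto (sqrtTail h) atTop (𝓝 0) :=
  tendsto_integral_Ioi_zero tendsto_id

namespace IsDecayRate

theorem hasDerivAt (hh : IsDecayRate h) {t : ℝ} (ht : 0 < t) : HasDerivAt h (deriv h t) t :=
  (hh.differentiableOn.differentiableAt (Ioi_mem_nhds ht)).hasDerivAt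

theorem deriv_nonpos (hh : IsDecayRate h) {t : ℝ} (ht : 0 < t) : deriv h t ≤ 0 := by
  rw [← derivWithin_of_mem_nhds (Ici_mem_nhds ht)]
  exact hh.antitoneOn.derivWithin_nonpos

theorem integrableOn_sqrt_Ioi (hh : IsDecayRate h) {a : ℝ} (ha : 0 ≤ a) :
    IntegrableOn (fun t => √(h t)) (Ioi a) :=
  hh.integrableOn_sqrt.mono_set (Ioi_subset_Ioi ha)

theorem intervalIntegrable_sqrt (hh : IsDecayRate h) {a b : ℝ} (ha : 0 ≤ a) (hab : a ≤ b) :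
    IntervalIntegrable (fun t => √(h t)) volume a b :=
  (intervalIntegrable_iff_integrableOn_Ioc_of_le hab).2
    ((hh.integrableOn_sqrt_Ioi ha).mono_set Ioc_subset_Ioi_self)

theorem integral_add_sqrtTail (hh : IsDecayRate h) {a b : ℝ} (ha : 0 ≤ a) (hab : a ≤ b) :
    (∫ s in a..b, √(h s)) + sqrtTail h b = sqrtTail h a :=
  intervalIntegral.integral_interval_add_Ioi (hh.integrableOn_sqrt_Ioi ha)
    (hh.integrableOn_sqrt_Ioi (ha.trans hab))

theorem antitoneOn_sqrtTail (hh : IsDecayRate h) : AntitoneOn (sqrtTail h) (Ici 0) :=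
  fun a ha b _ hab => by
    have := intervalIntegral.integral_nonneg (μ := volume) hab fun s _ => Real.sqrt_nonneg (h s)
    linarith [hh.integral_add_sqrtTail ha hab]

theorem sqrt_le_sqrtTail_sub_one (hh : IsDecayRate h) {t : ℝ} (ht : 1 ≤ t) :
    √(h t) ≤ sqrtTail h (t - 1) := by
  have h0 : 0 ≤ t - 1 := by linarith
  have hle : ∫ _ in (t - 1)..t, √(h t) ≤ ∫ s in (t - 1)..t, √(h s) :=
    intervalIntegral.integral_mono_on (by linarith) intervalIntegrable_const
      (hh.intervalIntegrable_sqrt h0 (by linarith)) fun s hs => Real.sqrt_le_sqrt <|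
        hh.antitoneOn (h0.trans hs.1) (zero_le_one.trans ht) hs.2
  rw [intervalIntegral.integral_const, sub_sub_cancel, one_smul] at hle
  linarith [hh.integral_add_sqrtTail h0 (show t - 1 ≤ t by linarith), sqrtTail_nonneg h t]

theorem sqrtTail_pos (hh : IsDecayRate h) {t : ℝ} (ht : 0 ≤ t) : 0 < sqrtTail h t := by
  have hle := hh.sqrt_le_sqrtTail_sub_one (t := t + 1) (by linarith)
  rw [add_sub_cancel_right] at hle
  exact (Real.sqrt_pos.2 (hh.pos _ (by linarith))).trans_le hle

theorem hasDerivAt_sqrtTail (hh : IsDecayRate h) {t : ℝ} (ht : 0 < t) :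
    HasDerivAt (sqrtTail h) (-√(h t)) t := by
  have hcont : ContinuousOn (fun t => √(h t)) (Ioi 0) := hh.differentiableOn.continuousOn.sqrt
  have hint : HasDerivAt (fun x => ∫ s in (0 : ℝ)..x, √(h s)) (√(h t)) t :=
    intervalIntegral.integral_hasDerivAt_right (hh.intervalIntegrable_sqrt le_rfl ht.le)
      (hcont.stronglyMeasurableAtFilter isOpen_Ioi t ht) (hcont.continuousAt (Ioi_mem_nhds ht))
  refine (hint.const_sub (sqrtTail h 0)).congr_of_eventuallyEq ?_
  filter_upwards [Ioi_mem_nhds ht] with x hx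
  exact eq_sub_of_add_eq' (hh.integral_add_sqrtTail le_rfl (le_of_lt hx))

theorem tendsto_zero (hh : IsDecayRate h) : Tendsto h atTop (𝓝 0) := by
  have hsqrt : Tendsto (fun t => √(h t)) atTop (𝓝 0) :=
    squeeze_zero' (Eventually.of_forall fun _ => Real.sqrt_nonneg _)
      ((eventually_ge_atTop 1).mono fun _ => hh.sqrt_le_sqrtTail_sub_one)
      ((tendsto_sqrtTail h).comp (tendsto_atTop_add_const_right _ (-1) tendsto_id))
  refine (by simpa using hsqrt.pow 2 : Tendsto (fun t => √(h t) ^ 2) atTop (𝓝 0)).congr' ?_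
  filter_upwards [eventually_ge_atTop 0] with t ht
  exact Real.sq_sqrt (hh.pos t ht).le

theorem tendsto_smul {E : Type*} [NormedAddCommGroup E] [NormedSpace ℝ E] (hh : IsDecayRate h)
    {g : ℝ → E} {M : ℝ} (hg : ∀ t, 0 ≤ t → ‖g t‖ ≤ M) :
    Tendsto (fun t => h t • g t) atTop (𝓝 0) :=
  hh.tendsto_zero.zero_smul_isBoundedUnder_le <| isBoundedUnder_of_eventually_le (a := M) <|
    (eventually_ge_atTop 0).mono hg

/-- Passing from large `t` to all `t ≥ 1` is possible since the tails of `√h` are bounded away from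
zero on bounded intervals. -/
theorem exists_le_mul_sqrtTail (hh : IsDecayRate h) {E : Type*} [SeminormedAddCommGroup E]
    {g : ℝ → E} {M : ℝ} (hM : ∀ t, 1 ≤ t → ‖g t‖ ≤ M)
    (hg : g =O[atTop] fun t => sqrtTail h (t - 1)) :
    ∃ C, ∀ t, 1 ≤ t → ‖g t‖ ≤ C * sqrtTail h (t - 1) := by
  obtain ⟨D, hD, hDg⟩ := hg.exists_pos
  obtain ⟨T, hT⟩ := eventually_atTop.1 (hDg.bound.and (eventually_ge_atTop 1))
  have hT1 : 1 ≤ T := (hT T le_rfl).2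
  have hpos : 0 < sqrtTail h (T - 1) := hh.sqrtTail_pos (by linarith)
  refine ⟨max D (M / sqrtTail h (T - 1)), fun t ht => ?_⟩
  have hnonneg := sqrtTail_nonneg h (t - 1)
  rcases le_total T t with hTt | htT
  · calc ‖g t‖ ≤ D * ‖sqrtTail h (t - 1)‖ := (hT t hTt).1
      _ = D * sqrtTail h (t - 1) := by rw [Real.norm_of_nonneg hnonneg]
      _ ≤ _ := by gcongr; exact le_max_left _ _
  · have hanti : sqrtTail h (T - 1) ≤ sqrtTail h (t - 1) :=
      hh.antitoneOn_sqrtTail (sub_nonneg.2 ht) (sub_nonneg.2 hT1) (by linarith)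
    have : 0 ≤ M := (norm_nonneg _).trans (hM t ht)
    calc ‖g t‖ ≤ M / sqrtTail h (T - 1) * sqrtTail h (T - 1) := by
          rw [div_mul_cancel₀ _ hpos.ne']; exact hM t ht
      _ ≤ max D (M / sqrtTail h (T - 1)) * sqrtTail h (t - 1) := by
          gcongr; exact le_max_right _ _

end IsDecayRate

end Rates

/-! ### The Łojasiewicz inequality -/

section ChainRule

variable {H X : Type*} [NormedAddCommGroup H] [InnerProductSpace ℝ H]
  [NormedAddCommGroup X] [NormedSpace ℝ X] {j : X →L[ℝ] H} {V : X → ℝ} {G : X → H}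

theorem IsGradient.continuous (hV : IsGradient j V G) : Continuous V :=
  continuous_iff_continuousAt.2 fun x => (hV x).continuousAt

theorem IsGradient.exists_sub_eq_inner (hV : IsGradient j V G) (x y : X) :
    ∃ z ∈ segment ℝ x y, V y - V x = inner ℝ (G z) (j (y - x)) := by
  obtain ⟨z, hz, hVz⟩ := domain_mvt (fun x _ => (hV x).hasFDerivWithinAt)
    (convex_segment x y) (left_mem_segment ℝ x y) (right_mem_segment ℝ x y)
  exact ⟨z, hz, by simpa using hVz⟩

/-- The curve `u` is only continuous in `X`, so that the usual chain rule does not apply; the mean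
value theorem writes the increment of `V ∘ u` as `⟪G z, j (u s) - j (u t)⟫` with `z → u t`. -/
theorem IsGradient.hasDerivAt_comp (hV : IsGradient j V G) (hG : Continuous G) {u : ℝ → X}
    {u' : H} {t : ℝ} (hu : ContinuousAt u t) (hju : HasDerivAt (fun s => j (u s)) u' t) :
    HasDerivAt (fun s => V (u s)) (inner ℝ (G (u t)) u') t := by
  have hmean : (fun s => V (u s) - V (u t) - inner ℝ (G (u t)) (j (u s) - j (u t)))
      =o[𝓝 t] fun s => j (u s) - j (u t) := by
    refine Asymptotics.isLittleO_iff.2 fun c hc => ?_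
    obtain ⟨δ, hδ, hball⟩ := Metric.continuousAt_iff.1 (hG.continuousAt (x := u t)) c hc
    filter_upwards [hu (Metric.ball_mem_nhds _ hδ)] with s hs
    obtain ⟨z, hz, hVz⟩ := hV.exists_sub_eq_inner (u t) (u s)
    have hzδ : z ∈ Metric.ball (u t) δ :=
      (convex_ball _ _).segment_subset (Metric.mem_ball_self hδ) hs hz
    rw [hVz, map_sub, ← inner_sub_left]
    refine (norm_inner_le_norm _ _).trans ?_
    gcongr
    rw [← dist_eq_norm]
    exact (hball hzδ).le
  have hinner : HasDerivAt (fun s => inner ℝ (G (u t)) (j (u s))) (inner ℝ (G (u t)) u') t := by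
    simpa using (hasDerivAt_const t (G (u t))).inner ℝ hju
  rw [hasDerivAt_iff_isLittleO] at hinner ⊢
  refine ((hmean.trans_isBigO hju.isBigO_sub).add hinner).congr_left fun s => ?_
  rw [inner_sub_right]
  ring

theorem IsGradient.abs_sub_le_of_lipschitzOnWith (hV : IsGradient j V G) {s : Set X}
    (hs : Convex ℝ s) {M : NNReal} (hG : LipschitzOnWith M G s) {x w : X} (hx : x ∈ s)
    (hw : w ∈ s) (hw0 : G w = 0) : |V x - V w| ≤ M * ‖j‖ * ‖x - w‖ ^ 2 := by
  obtain ⟨z, hz, hVz⟩ := hV.exists_sub_eq_inner w x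
  have hzw : ‖z - w‖ ≤ ‖x - w‖ := by
    rw [← dist_eq_norm, ← dist_eq_norm, dist_comm z, dist_comm x,
      ← dist_add_dist_of_mem_segment hz]
    exact le_add_of_nonneg_right dist_nonneg
  have hGz : ‖G z‖ ≤ M * ‖x - w‖ :=
    calc ‖G z‖ = ‖G z - G w‖ := by rw [hw0, sub_zero]
      _ ≤ M * ‖z - w‖ := hG.norm_sub_le (hs.segment_subset hw hx hz) hw
      _ ≤ M * ‖x - w‖ := by gcongr
  calc |V x - V w| ≤ ‖G z‖ * ‖j (x - w)‖ := hVz ▸ abs_real_inner_le_norm _ _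
    _ ≤ (M * ‖x - w‖) * (‖j‖ * ‖x - w‖) := by gcongr; exact j.le_opNorm _
    _ = M * ‖j‖ * ‖x - w‖ ^ 2 := by ring

theorem IsGradient.eq_of_forall_gradient_eq_zero (hV : IsGradient j V G) {E : Type*}
    [NormedAddCommGroup E] [NormedSpace ℝ E] {φ : E → X} {s : Set E} (hs : Convex ℝ s)
    (hφ : DifferentiableOn ℝ φ s) (hG : ∀ y ∈ s, G (φ y) = 0) {y z : E} (hy : y ∈ s)
    (hz : z ∈ s) : V (φ z) = V (φ y) := by
  have hderiv : ∀ x ∈ s, HasFDerivWithinAt (V ∘ φ) (0 : E →L[ℝ] ℝ) s x := fun x hx => by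
    refine ((hV (φ x)).comp_hasFDerivWithinAt x (hφ x hx).hasFDerivWithinAt).congr_fderiv ?_
    simp [hG x hx]
  have hle := hs.norm_image_sub_le_of_norm_hasFDerivWithin_le (C := 0) hderiv (by simp) hy hz
  rw [zero_mul] at hle
  exact sub_eq_zero.1 (norm_le_zero_iff.1 hle)

end ChainRule

theorem exists_norm_le_mul_of_isClosed_range {𝕜 X H : Type*} [NontriviallyNormedField 𝕜]
    [NormedAddCommGroup X] [NormedSpace 𝕜 X] [CompleteSpace X] [NormedAddCommGroup H]
    [NormedSpace 𝕜 H] [CompleteSpace H] {A : X →L[𝕜] H} (hA : IsClosed (A.range : Set H))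
    {P : X →L[𝕜] A.ker} (hP : ∀ x : A.ker, P x = x) :
    ∃ K > 0, ∀ v, P v = 0 → ‖v‖ ≤ K * ‖A v‖ := by
  let L : P.ker →L[𝕜] H := A.comp P.ker.subtypeL
  have hinj : Function.Injective L := (injective_iff_map_eq_zero L).2 fun v hv => by
    have hPv : P v = ⟨v, hv⟩ := hP ⟨v, hv⟩
    exact Subtype.ext (congrArg (fun k : A.ker => (k : X)) (hPv.symm.trans v.2))
  have hrange : Set.range L = (A.range : Set H) := by
    refine Subset.antisymm (range_subset_iff.2 fun v => ?_) ?_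
    · exact ⟨(v : X), rfl⟩
    · rintro _ ⟨x, rfl⟩
      have hPx : A (P x) = 0 := (P x).2
      exact ⟨⟨x - P x, by simp [hP]⟩, by simp [L, hPx]⟩
  have : CompleteSpace P.ker := P.isClosed_ker.completeSpace_coe
  obtain ⟨K, hK⟩ := L.antilipschitz_of_injective_of_isClosed_range hinj (hrange ▸ hA)
  refine ⟨K + 1, by positivity, fun v hv => ?_⟩
  calc ‖v‖ ≤ K * ‖A v‖ := hK.le_mul_norm (map_zero L) ⟨v, hv⟩
    _ ≤ (K + 1) * ‖A v‖ := by gcongr; simp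

theorem eventually_norm_sub_le_mul {𝕜 X H E : Type*} [NontriviallyNormedField 𝕜]
    [NormedAddCommGroup X] [NormedSpace 𝕜 X] [NormedAddCommGroup H] [NormedSpace 𝕜 H]
    [NormedAddCommGroup E] [NormedSpace 𝕜 E] {G : X → H} {A : X →L[𝕜] H} {ψ : X}
    (hA : HasStrictFDerivAt G A ψ) {P : X →L[𝕜] E} {K : ℝ} (hK : 0 < K)
    (hKP : ∀ v, P v = 0 → ‖v‖ ≤ K * ‖A v‖) :
    ∀ᶠ p : X × X in 𝓝 (ψ, ψ), P p.1 = P p.2 → ‖p.1 - p.2‖ ≤ 2 * K * ‖G p.1 - G p.2‖ := by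
  filter_upwards [hA.isLittleO.def (show 0 < (2 * K)⁻¹ by positivity)] with p hp hPp
  have hlin : ‖p.1 - p.2‖ ≤ K * ‖A (p.1 - p.2)‖ := hKP _ (by rw [map_sub, hPp, sub_self])
  have hAG : ‖A (p.1 - p.2)‖ ≤ ‖G p.1 - G p.2‖ + (2 * K)⁻¹ * ‖p.1 - p.2‖ := by
    have := norm_sub_norm_le (A (p.1 - p.2)) (G p.1 - G p.2)
    rw [norm_sub_rev (A (p.1 - p.2))] at this
    linarith
  have habsorb : K * ((2 * K)⁻¹ * ‖p.1 - p.2‖) = ‖p.1 - p.2‖ / 2 := by field_simp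
  nlinarith

theorem apply_eq_zero_of_eventually_eq_zero {𝕜 X H E : Type*} [NontriviallyNormedField 𝕜]
    [NormedAddCommGroup X] [NormedSpace 𝕜 X] [NormedAddCommGroup H] [NormedSpace 𝕜 H]
    [NormedAddCommGroup E] [NormedSpace 𝕜 E] {G : X → H} {A : X →L[𝕜] H} {φ : E → X}
    {φ' : E →L[𝕜] X} {m : E} (hφ : HasFDerivAt φ φ' m) (hA : HasFDerivAt G A (φ m))
    (hG : ∀ᶠ y in 𝓝 m, G (φ y) = 0) (v : E) : A (φ' v) = 0 := by
  have hzero : HasFDerivAt (fun y => G (φ y)) (0 : E →L[𝕜] H) m :=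
    (hasFDerivAt_const (0 : H) m).congr_of_eventuallyEq hG
  exact congrArg (fun T : E →L[𝕜] H => T v) ((hA.comp m hφ).unique hzero)

section Lojasiewicz

variable {H X : Type*} [NormedAddCommGroup H] [InnerProductSpace ℝ H]
  [NormedAddCommGroup X] [NormedSpace ℝ X] {j : X →L[ℝ] H} {V : X → ℝ} {G : X → H}
  {A : X →L[ℝ] H} {ψ : X}

/-- The tangent space of the manifold is the whole kernel of `A`, so that the projection `P` to
the kernel maps the manifold onto a neighbourhood of `P ψ`. -/
theorem IsGradient.eventually_exists_equilibrium (hV : IsGradient j V G)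
    (hA : HasFDerivAt G A ψ) [FiniteDimensional ℝ A.ker] {P : X →L[ℝ] A.ker}
    (hP : ∀ x : A.ker, P x = x)
    (hM : IsLocalManifoldAt (Module.finrank ℝ A.ker) (equilibria G) ψ) {S : Set X}
    (hS : S ∈ 𝓝 ψ) :
    ∀ᶠ x in 𝓝 ψ, ∃ w ∈ S, G w = 0 ∧ P w = P x ∧ V w = V ψ := by
  obtain ⟨O, U, φ, -, -, hU, hφ, himm, -, himg, m, hmU, rfl⟩ := hM
  have hφ0 : ∀ y ∈ U, G (φ y) = 0 := fun y hy => (himg.subset (mem_image_of_mem φ hy)).1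
  have hφm : HasStrictFDerivAt φ (fderiv ℝ φ m) m :=
    (hφ.contDiffAt (hU.mem_nhds hmU)).hasStrictFDerivAt one_ne_zero
  have hker : ∀ v, A (fderiv ℝ φ m v) = 0 :=
    apply_eq_zero_of_eventually_eq_zero hφm.hasFDerivAt hA
      (eventually_of_mem (hU.mem_nhds hmU) hφ0)
  have hPφ : ∀ v, (P (fderiv ℝ φ m v) : X) = fderiv ℝ φ m v := fun v =>
    congrArg Subtype.val (hP ⟨_, hker v⟩)
  have hinj : Function.Injective (P.comp (fderiv ℝ φ m)) := fun v w hvw =>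
    himm m hmU (by rw [← hPφ v, ← hPφ w]; exact congrArg Subtype.val hvw)
  have hsurj : (P.comp (fderiv ℝ φ m)).range = ⊤ := LinearMap.range_eq_top.2 <|
    (LinearMap.injective_iff_surjective_of_finrank_eq_finrank (by simp)).1 hinj
  obtain ⟨r, hr, hrU⟩ := Metric.isOpen_iff.1 hU m hmU
  have hnear : φ ⁻¹' S ∩ Metric.ball m r ∈ 𝓝 m :=
    inter_mem (hφm.continuousAt hS) (Metric.ball_mem_nhds m hr)
  have himage : (P ∘ φ) '' (φ ⁻¹' S ∩ Metric.ball m r) ∈ 𝓝 (P (φ m)) :=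
    (P.hasStrictFDerivAt.comp m hφm).map_nhds_eq_of_surj hsurj ▸ image_mem_map hnear
  filter_upwards [P.continuous.continuousAt himage] with x ⟨y, ⟨hyS, hyr⟩, hyx⟩
  exact ⟨φ y, hyS, hφ0 y (hrU hyr), hyx, hV.eq_of_forall_gradient_eq_zero (convex_ball m r)
    ((hφ.differentiableOn one_ne_zero).mono hrU) (fun z hz => hφ0 z (hrU hz))
    (Metric.mem_ball_self hr) hyr⟩

/-- If `w` is an equilibrium on the level of `ψ` with `P w = P x`, then `V x - V w` is quadratic
in `x - w`, which is in turn controlled by `G x - G w = G x`. -/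
theorem IsGradient.isBigO_of_eventually_exists_equilibrium (hV : IsGradient j V G)
    (hA : HasStrictFDerivAt G A ψ) {E : Type*} [NormedAddCommGroup E] [NormedSpace ℝ E]
    {P : X →L[ℝ] E} {K : ℝ} (hK : 0 < K) (hKP : ∀ v, P v = 0 → ‖v‖ ≤ K * ‖A v‖)
    (hw : ∀ S ∈ 𝓝 ψ, ∀ᶠ x in 𝓝 ψ, ∃ w ∈ S, G w = 0 ∧ P w = P x ∧ V w = V ψ) :
    (fun x => V x - V ψ) =O[𝓝 ψ] fun x => ‖G x‖ ^ 2 := by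
  obtain ⟨S, hS, hdist⟩ := eventually_prod_self_iff'.1
    (nhds_prod_eq (x := ψ) (y := ψ) ▸ eventually_norm_sub_le_mul hA hK hKP)
  obtain ⟨M, T, hT, hlip⟩ := hA.exists_lipschitzOnWith
  obtain ⟨r, hr, hball⟩ := Metric.mem_nhds_iff.1 (inter_mem hS hT)
  refine Asymptotics.IsBigO.of_bound (M * ‖j‖ * (2 * K) ^ 2) ?_
  filter_upwards [hw _ (Metric.ball_mem_nhds ψ hr), Metric.ball_mem_nhds ψ hr]
    with x ⟨w, hwr, hw0, hPw, hVw⟩ hxr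
  have hxw : ‖x - w‖ ≤ 2 * K * ‖G x‖ := by
    simpa [hw0] using hdist x (hball hxr).1 w (hball hwr).1 hPw.symm
  calc ‖V x - V ψ‖ = |V x - V w| := by rw [hVw, Real.norm_eq_abs]
    _ ≤ M * ‖j‖ * ‖x - w‖ ^ 2 := hV.abs_sub_le_of_lipschitzOnWith (convex_ball ψ r)
        (hlip.mono fun z hz => (hball hz).2) hxr hwr hw0
    _ ≤ M * ‖j‖ * (2 * K * ‖G x‖) ^ 2 := by gcongr
    _ = M * ‖j‖ * (2 * K) ^ 2 * ‖‖G x‖ ^ 2‖ := by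
        rw [Real.norm_of_nonneg (by positivity)]; ring

theorem IsGradient.lojasiewicz [CompleteSpace H] [CompleteSpace X] (hV : IsGradient j V G)
    (hψ : G ψ = 0) (hA : HasStrictFDerivAt G A ψ) [FiniteDimensional ℝ A.ker]
    (hrange : IsClosed (A.range : Set H))
    (hM : A.ker = ⊥ ∨ IsLocalManifoldAt (Module.finrank ℝ A.ker) (equilibria G) ψ) :
    (fun x => V x - V ψ) =O[𝓝 ψ] fun x => ‖G x‖ ^ 2 := by
  obtain ⟨P, hP⟩ := Submodule.ClosedComplemented.of_finiteDimensional A.ker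
  obtain ⟨K, hK, hKP⟩ := exists_norm_le_mul_of_isClosed_range hrange hP
  refine hV.isBigO_of_eventually_exists_equilibrium hA hK hKP fun S hS => ?_
  rcases hM with hker | hman
  · have := (Submodule.subsingleton_iff_eq_bot).2 hker
    exact Eventually.of_forall fun x => ⟨ψ, mem_of_mem_nhds hS, hψ, Subsingleton.elim _ _, rfl⟩
  · exact hV.eventually_exists_equilibrium hA.hasFDerivAt hP hman hS

end Lojasiewicz

/-! ### Curves with a decreasing energy -/

section Attraction

variable {E : Type*}

/-- The curve `f` is attracted to `S`, in the sequential form supplied by compactness arguments: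
every sequence of times tending to infinity has a subsequence along which `f` converges to a point
of `S`. -/
def IsSeqAttractedTo [TopologicalSpace E] (f : ℝ → E) (S : Set E) : Prop :=
  ∀ s : ℕ → ℝ, Tendsto s atTop atTop →
    ∃ z ∈ S, ∃ φ : ℕ → ℕ, StrictMono φ ∧ Tendsto (fun n => f (s (φ n))) atTop (𝓝 z)

namespace IsSeqAttractedTo

theorem mem_of_tendsto [TopologicalSpace E] [T2Space E] {f : ℝ → E} {S : Set E}
    (hf : IsSeqAttractedTo f S) {s : ℕ → ℝ} (hs : Tendsto s atTop atTop) {y : E}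
    (hy : Tendsto (fun n => f (s n)) atTop (𝓝 y)) : y ∈ S := by
  obtain ⟨z, hz, φ, hφ, hlim⟩ := hf s hs
  rwa [tendsto_nhds_unique (hy.comp hφ.tendsto_atTop) hlim]

theorem exists_mapClusterPt [TopologicalSpace E] {f : ℝ → E} {S : Set E}
    (hf : IsSeqAttractedTo f S) : ∃ y ∈ S, MapClusterPt y atTop f := by
  obtain ⟨y, hy, φ, hφ, hlim⟩ := hf (fun n => n) tendsto_natCast_atTop_atTop
  exact ⟨y, hy, hlim.mapClusterPt.of_comp (tendsto_natCast_atTop_atTop.comp hφ.tendsto_atTop)⟩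

theorem eventually_notMem [TopologicalSpace E] {f : ℝ → E} {S C : Set E}
    (hf : IsSeqAttractedTo f S) (hC : IsClosed C) (hSC : Disjoint S C) :
    ∀ᶠ t in atTop, f t ∉ C := by
  by_contra hfreq
  obtain ⟨s, hs, hsC⟩ := exists_seq_forall_of_frequently (not_eventually.1 hfreq)
  obtain ⟨z, hz, φ, -, hlim⟩ := hf s hs
  exact disjoint_left.1 hSC hz <|
    hC.mem_of_tendsto hlim (Eventually.of_forall fun n => not_not.1 (hsC (φ n)))

/-- The curve eventually avoids every small sphere around the isolated point, so that it cannot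
leave the ball which it keeps visiting. -/
theorem tendsto_of_not_accPt [MetricSpace E] {f : ℝ → E} {S : Set E}
    (hf : IsSeqAttractedTo f S) {a : ℝ} (hcont : ContinuousOn f (Ici a)) {y : E}
    (hy : MapClusterPt y atTop f) (hacc : ¬ AccPt y (𝓟 S)) : Tendsto f atTop (𝓝 y) := by
  rw [accPt_iff_frequently, not_frequently, Metric.eventually_nhds_iff] at hacc
  obtain ⟨r, hr, hiso⟩ := hacc
  refine Metric.tendsto_nhds.2 fun ε hε => ?_
  obtain ⟨ρ, hρ, hρmin⟩ := exists_between (lt_min hε hr)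
  obtain ⟨hρε, hρr⟩ := lt_min_iff.1 hρmin
  have hsphere : ∀ᶠ t in atTop, dist (f t) y ≠ ρ := by
    refine hf.eventually_notMem Metric.isClosed_sphere (disjoint_left.2 fun z hzS hz => ?_)
    have hzρ : dist z y = ρ := hz
    exact hiso (hzρ.trans_lt hρr) ⟨dist_pos.1 (hzρ ▸ hρ), hzS⟩
  obtain ⟨T, hT⟩ := eventually_atTop.1 (hsphere.and (eventually_ge_atTop a))
  obtain ⟨b, hb, hTb⟩ :=
    ((hy.frequently (Metric.ball_mem_nhds y hρ)).and_eventually (eventually_ge_atTop T)).exists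
  filter_upwards [eventually_ge_atTop b] with t ht
  by_contra! hεt
  have hdist : ContinuousOn (fun t => dist (f t) y) (Icc b t) :=
    (continuous_id.dist continuous_const).comp_continuousOn
      (hcont.mono fun x hx => (hT b hTb).2.trans hx.1)
  obtain ⟨x, hx, hxρ⟩ := intermediate_value_Icc ht hdist ⟨(Metric.mem_ball.1 hb).le,
    hρε.le.trans hεt⟩
  exact (hT x (hTb.trans hx.1)).1 hxρ

end IsSeqAttractedTo

theorem forall_mem_of_forall_Ico_imp_mem {α : Type*} [ConditionallyCompleteLinearOrder α]
    [TopologicalSpace α] [OrderTopology α] [TopologicalSpace E] {f : α → E} {U : Set E} {a : α}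
    (hf : ContinuousOn f (Ici a)) (hU : IsOpen U)
    (hstep : ∀ b, a ≤ b → (∀ t ∈ Ico a b, f t ∈ U) → f b ∈ U) {t : α} (ht : a ≤ t) :
    f t ∈ U := by
  by_contra htU
  let exits : Set α := Ici a ∩ f ⁻¹' Uᶜ
  have hclosed : IsClosed exits := hf.preimage_isClosed_of_isClosed isClosed_Ici hU.isClosed_compl
  have hbdd : BddBelow exits := ⟨a, fun s hs => hs.1⟩
  have hfirst : sInf exits ∈ exits := hclosed.csInf_mem ⟨t, ht, htU⟩ hbdd
  refine hfirst.2 (hstep _ hfirst.1 fun s hs => ?_)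
  by_contra hsU
  exact notMem_of_lt_csInf hs.2 hbdd ⟨hs.1, hsU⟩

end Attraction

section Dissipation

variable {E : Type*} [NormedAddCommGroup E] [NormedSpace ℝ E] {f : ℝ → E} {e h : ℝ → ℝ}

theorem norm_sub_le_sub_of_norm_deriv_le {B : ℝ → ℝ} {a b : ℝ} (hab : a ≤ b)
    (hf : ∀ t ∈ Icc a b, DifferentiableAt ℝ f t) (hB : ∀ t ∈ Icc a b, DifferentiableAt ℝ B t)
    (hle : ∀ t ∈ Ico a b, ‖deriv f t‖ ≤ deriv B t) : ‖f b - f a‖ ≤ B b - B a :=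
  image_norm_le_of_norm_deriv_right_le_deriv_boundary' (f := fun t => f t - f a)
    (B := fun t => B t - B a)
    (fun t ht => ((hf t ht).continuousAt.sub continuousAt_const).continuousWithinAt)
    (fun t ht => ((hf t (Ico_subset_Icc_self ht)).hasDerivAt.sub_const _).hasDerivWithinAt)
    (by simp)
    (fun t ht => ((hB t ht).continuousAt.sub continuousAt_const).continuousWithinAt)
    (fun t ht => ((hB t (Ico_subset_Icc_self ht)).hasDerivAt.sub_const _).hasDerivWithinAt)
    hle (right_mem_Icc.2 hab)

/-- A curve `f` together with an energy `e` that decreases along it at least as fast as the squared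
speed: `e' ≤ -‖f'‖²` on `(0, ∞)`. -/
structure IsDissipative (f : ℝ → E) (e : ℝ → ℝ) : Prop where
  differentiableOn : DifferentiableOn ℝ f (Ioi 0)
  differentiableOn_energy : DifferentiableOn ℝ e (Ioi 0)
  deriv_energy_le : ∀ t, 0 < t → deriv e t ≤ -‖deriv f t‖ ^ 2

namespace IsDissipative

theorem differentiableAt (hd : IsDissipative f e) {t : ℝ} (ht : 0 < t) : DifferentiableAt ℝ f t :=
  hd.differentiableOn.differentiableAt (Ioi_mem_nhds ht)

theorem differentiableAt_energy (hd : IsDissipative f e) {t : ℝ} (ht : 0 < t) :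
    DifferentiableAt ℝ e t :=
  hd.differentiableOn_energy.differentiableAt (Ioi_mem_nhds ht)

theorem deriv_energy_nonpos (hd : IsDissipative f e) {t : ℝ} (ht : 0 < t) : deriv e t ≤ 0 :=
  (hd.deriv_energy_le t ht).trans (neg_nonpos.2 (sq_nonneg _))

theorem antitoneOn_energy (hd : IsDissipative f e) : AntitoneOn e (Ioi 0) := by
  refine antitoneOn_of_deriv_nonpos (convex_Ioi 0) hd.differentiableOn_energy.continuousOn ?_ ?_ <;>
    rw [interior_Ioi]
  exacts [hd.differentiableOn_energy, fun t ht => hd.deriv_energy_nonpos ht]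

theorem exists_tendsto_energy (hd : IsDissipative f e) {m : ℝ} (hm : ∀ t, 0 < t → m ≤ e t) :
    ∃ l, Tendsto e atTop (𝓝 l) := by
  have hpos (t : ℝ) : 0 < max t 1 := zero_lt_one.trans_le (le_max_right t 1)
  have hanti : Antitone fun t => e (max t 1) := fun s t hst =>
    hd.antitoneOn_energy (hpos s) (hpos t) (max_le_max_right 1 hst)
  refine ⟨_, (tendsto_atTop_ciInf hanti ⟨m, ?_⟩).congr' ?_⟩
  · rintro _ ⟨t, rfl⟩
    exact hm _ (hpos t)
  · filter_upwards [eventually_ge_atTop 1] with t ht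
    rw [max_eq_left ht]

theorem le_energy_of_tendsto (hd : IsDissipative f e) {l : ℝ} (hl : Tendsto e atTop (𝓝 l)) {t : ℝ}
    (ht : 0 < t) : l ≤ e t :=
  le_of_tendsto hl <| (eventually_ge_atTop t).mono fun _ hts =>
    hd.antitoneOn_energy ht (ht.trans_le hts) hts

/-- Integrate `2 c L ‖f'‖ ≤ c² + L² ‖f'‖² ≤ c² - L² e'`, where `c = ‖f b - f a‖` and
`L = b - a`. -/
theorem norm_sub_sq_le (hd : IsDissipative f e) {a b : ℝ} (ha : 0 < a) (hab : a ≤ b) :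
    ‖f b - f a‖ ^ 2 ≤ (b - a) * (e a - e b) := by
  rcases hab.eq_or_lt with rfl | hlt
  · simp
  set c := ‖f b - f a‖
  set L := b - a with hL_def
  have hL : 0 < L := sub_pos.2 hlt
  have : 0 ≤ c := norm_nonneg _
  have hB (t : ℝ) (ht : a ≤ t) :
      HasDerivAt (fun t => c ^ 2 * t - L ^ 2 * e t) (c ^ 2 * 1 - L ^ 2 * deriv e t) t :=
    ((hasDerivAt_id t).const_mul _).sub
      ((hd.differentiableAt_energy (ha.trans_le ht)).hasDerivAt.const_mul _)
  have hint := norm_sub_le_sub_of_norm_deriv_le (f := fun t => (2 * c * L) • f t) hab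
    (fun t ht => (hd.differentiableAt (ha.trans_le ht.1)).const_smul _)
    (fun t ht => (hB t ht.1).differentiableAt) fun t ht => by
      rw [deriv_fun_const_smul _ (hd.differentiableAt (ha.trans_le ht.1)), (hB t ht.1).deriv,
        norm_smul, Real.norm_of_nonneg (by positivity)]
      have henergy := mul_le_mul_of_nonneg_left (hd.deriv_energy_le t (ha.trans_le ht.1))
        (sq_nonneg L)
      linarith [sq_nonneg (c - L * ‖deriv f t‖)]
  rw [← smul_sub, norm_smul, Real.norm_of_nonneg (by positivity)] at hint
  refine le_of_mul_le_mul_left ?_ hL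
  linear_combination hint + c ^ 2 * hL_def

theorem exists_norm_sq_le (hd : IsDissipative f e) {t : ℝ} (ht : 0 < t) :
    ∃ τ, t ≤ τ ∧ ‖deriv f τ‖ ^ 2 ≤ e t - e (t + 1) ∧ ‖f τ - f t‖ ^ 2 ≤ e t - e (t + 1) := by
  obtain ⟨τ, ⟨htτ, hτt⟩, hslope⟩ := exists_deriv_eq_slope e (lt_add_one t)
    (hd.differentiableOn_energy.continuousOn.mono fun s hs => ht.trans_le hs.1)
    (hd.differentiableOn_energy.mono fun s hs => ht.trans hs.1)
  rw [add_sub_cancel_left, div_one] at hslope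
  have hτ : 0 < τ := ht.trans htτ
  refine ⟨τ, htτ.le, by linarith [hd.deriv_energy_le τ hτ], ?_⟩
  calc ‖f τ - f t‖ ^ 2 ≤ (τ - t) * (e t - e τ) := hd.norm_sub_sq_le ht htτ.le
    _ ≤ 1 * (e t - e τ) := by
        gcongr
        · exact sub_nonneg.2 (hd.antitoneOn_energy ht hτ htτ.le)
        · linarith
    _ ≤ e t - e (t + 1) := by
        linarith [hd.antitoneOn_energy hτ (show 0 < t + 1 by linarith) hτt.le]

theorem exists_shift (hd : IsDissipative f e) {l : ℝ} (hl : Tendsto e atTop (𝓝 l)) :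
    ∃ τ : ℝ → ℝ, (∀ t, t ≤ τ t) ∧ Tendsto (fun t => deriv f (τ t)) atTop (𝓝 0) ∧
      Tendsto (fun t => f (τ t) - f t) atTop (𝓝 0) := by
  have hex (t : ℝ) : ∃ τ, t ≤ τ ∧
      (0 < t → ‖deriv f τ‖ ^ 2 ≤ e t - e (t + 1) ∧ ‖f τ - f t‖ ^ 2 ≤ e t - e (t + 1)) := by
    by_cases ht : 0 < t
    · obtain ⟨τ, htτ, hτ⟩ := hd.exists_norm_sq_le ht
      exact ⟨τ, htτ, fun _ => hτ⟩
    · exact ⟨t, le_rfl, fun h => absurd h ht⟩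
  choose τ hτ hle using hex
  have hgap : Tendsto (fun t => √(e t - e (t + 1))) atTop (𝓝 0) := by
    simpa using (hl.sub (hl.comp (tendsto_atTop_add_const_right _ 1 tendsto_id))).sqrt
  refine ⟨τ, hτ, squeeze_zero_norm' ?_ hgap, squeeze_zero_norm' ?_ hgap⟩ <;>
    filter_upwards [eventually_gt_atTop 0] with t ht
  exacts [Real.le_sqrt_of_sq_le (hle t ht).1, Real.le_sqrt_of_sq_le (hle t ht).2]

end IsDissipative

/-- The bound for the length of the curve after time `t` that results from
`h ≤ e ≤ C (‖f'‖² + h)`: where `‖f'‖² ≤ h` the speed is at most `√h`, and elsewhere it is at most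
`-√(2 C) e' / √e`. -/
noncomputable def lengthBound (h e : ℝ → ℝ) (C t : ℝ) : ℝ :=
  sqrtTail h t + 2 * √(2 * C) * √(e t)

theorem lengthBound_nonneg (h e : ℝ → ℝ) (C t : ℝ) : 0 ≤ lengthBound h e C t :=
  add_nonneg (sqrtTail_nonneg h t) (by positivity)

theorem tendsto_lengthBound (h : ℝ → ℝ) (he : Tendsto e atTop (𝓝 0)) (C : ℝ) :
    Tendsto (lengthBound h e C) atTop (𝓝 0) := by
  have hlim := (tendsto_sqrtTail h).add (he.sqrt.const_mul (2 * √(2 * C)))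
  rwa [Real.sqrt_zero, mul_zero, add_zero] at hlim

theorem IsDecayRate.hasDerivAt_lengthBound (hh : IsDecayRate h) {e' C t : ℝ} (ht : 0 < t)
    (he : HasDerivAt e e' t) (het : 0 < e t) :
    HasDerivAt (lengthBound h e C) (-√(h t) + √(2 * C) * e' / √(e t)) t :=
  ((hh.hasDerivAt_sqrtTail ht).add ((he.sqrt het.ne').const_mul _)).congr_deriv (by
    field_simp)

namespace IsDissipative

variable {C : ℝ} {p : E}

theorem norm_deriv_le (hd : IsDissipative f e) (hC : 0 ≤ C) {t : ℝ} (ht : 0 < t) (het : 0 < e t)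
    (hle : e t ≤ C * (‖deriv f t‖ ^ 2 + h t)) :
    ‖deriv f t‖ ≤ √(h t) - √(2 * C) * deriv e t / √(e t) := by
  have hs : 0 < √(e t) := Real.sqrt_pos.2 het
  rcases le_or_gt (‖deriv f t‖ ^ 2) (h t) with hslow | hfast
  · have hdrop : √(2 * C) * deriv e t / √(e t) ≤ 0 := div_nonpos_of_nonpos_of_nonneg
      (mul_nonpos_of_nonneg_of_nonpos (Real.sqrt_nonneg _) (hd.deriv_energy_nonpos ht)) hs.le
    linarith [Real.le_sqrt_of_sq_le hslow]
  · have henergy : √(e t) ≤ √(2 * C) * ‖deriv f t‖ := by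
      rw [← Real.sqrt_sq (norm_nonneg (deriv f t)), ← Real.sqrt_mul (by positivity)]
      exact Real.sqrt_le_sqrt (by nlinarith)
    have hspeed : ‖deriv f t‖ ≤ √(2 * C) * -deriv e t / √(e t) := by
      rw [le_div_iff₀ hs]
      calc ‖deriv f t‖ * √(e t) ≤ ‖deriv f t‖ * (√(2 * C) * ‖deriv f t‖) := by gcongr
        _ = √(2 * C) * ‖deriv f t‖ ^ 2 := by ring
        _ ≤ √(2 * C) * -deriv e t := by gcongr; exact le_neg_of_le_neg (hd.deriv_energy_le t ht)
    rw [mul_neg, neg_div] at hspeed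
    linarith [Real.sqrt_nonneg (h t)]

theorem norm_sub_le_lengthBound (hd : IsDissipative f e) (hh : IsDecayRate h)
    (he : ∀ t, 0 < t → h t ≤ e t) (hC : 0 ≤ C) {a b : ℝ} (ha : 0 < a) (hab : a ≤ b)
    (hle : ∀ t ∈ Ico a b, e t ≤ C * (‖deriv f t‖ ^ 2 + h t)) :
    ‖f b - f a‖ ≤ lengthBound h e C a := by
  have hpos (t : ℝ) (ht : a ≤ t) : 0 < t := ha.trans_le ht
  have hepos (t : ℝ) (ht : a ≤ t) : 0 < e t :=
    (hh.pos t (hpos t ht).le).trans_le (he t (hpos t ht))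
  have hbound (t : ℝ) (ht : a ≤ t) := (hh.hasDerivAt_lengthBound (C := C) (hpos t ht)
    (hd.differentiableAt_energy (hpos t ht)).hasDerivAt (hepos t ht)).neg
  have hlength := norm_sub_le_sub_of_norm_deriv_le hab
    (fun t ht => hd.differentiableAt (hpos t ht.1)) (fun t ht => (hbound t ht.1).differentiableAt)
    fun t ht => by
      rw [(hbound t ht.1).deriv, neg_add, neg_neg]
      exact hd.norm_deriv_le hC (hpos t ht.1) (hepos t ht.1) (hle t ht)
  simp only [Pi.neg_apply] at hlength
  linarith [lengthBound_nonneg h e C b]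

/-- A curve that comes close to `p` at a late time has too little length left to leave a ball
around `p` on which `e ≤ C (‖f'‖² + h)`. -/
theorem tendsto_of_mapClusterPt (hd : IsDissipative f e) (hh : IsDecayRate h)
    (he : ∀ t, 0 < t → h t ≤ e t) (he0 : Tendsto e atTop (𝓝 0)) (hC : 0 ≤ C)
    (hp : MapClusterPt p atTop f) {U : Set E} (hU : U ∈ 𝓝 p)
    (hle : ∀ t, 0 < t → f t ∈ U → e t ≤ C * (‖deriv f t‖ ^ 2 + h t)) :
    Tendsto f atTop (𝓝 p) := by
  obtain ⟨r, hr, hrU⟩ := Metric.mem_nhds_iff.1 hU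
  refine Metric.tendsto_nhds.2 fun ε hε => ?_
  set δ := min ε r
  have hδ : 0 < δ := lt_min hε hr
  have hlate : ∀ᶠ t in atTop, 0 < t ∧ lengthBound h e C t < δ / 2 :=
    (eventually_gt_atTop 0).and ((tendsto_lengthBound h he0 C).eventually_lt_const (half_pos hδ))
  obtain ⟨a, hfa, ha, hsmall⟩ :=
    ((hp.frequently (Metric.ball_mem_nhds p (half_pos hδ))).and_eventually hlate).exists
  have htrap (t : ℝ) (ht : a ≤ t) : f t ∈ Metric.ball p δ := by
    refine forall_mem_of_forall_Ico_imp_mem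
      (fun s hs => (hd.differentiableAt (ha.trans_le hs)).continuousAt.continuousWithinAt)
      Metric.isOpen_ball (fun b hab hb => ?_) ht
    have hlength : ‖f b - f a‖ ≤ lengthBound h e C a :=
      hd.norm_sub_le_lengthBound hh he hC ha hab fun s hs =>
        hle s (ha.trans_le hs.1) (hrU (Metric.ball_subset_ball (min_le_right ε r) (hb s hs)))
    rw [← dist_eq_norm] at hlength
    rw [Metric.mem_ball]
    linarith [dist_triangle (f b) (f a) p]
  filter_upwards [eventually_ge_atTop a] with t ht
  exact (htrap t ht).trans_le (min_le_left ε r)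

theorem eventually_norm_sub_le_lengthBound (hd : IsDissipative f e) (hh : IsDecayRate h)
    (he : ∀ t, 0 < t → h t ≤ e t) (hC : 0 ≤ C) (hp : Tendsto f atTop (𝓝 p))
    (hle : ∀ᶠ t in atTop, e t ≤ C * (‖deriv f t‖ ^ 2 + h t)) :
    ∀ᶠ t in atTop, ‖f t - p‖ ≤ lengthBound h e C t := by
  obtain ⟨T, hT⟩ := eventually_atTop.1 hle
  filter_upwards [eventually_ge_atTop T, eventually_gt_atTop 0] with t hTt ht
  rw [norm_sub_rev]
  refine le_of_tendsto (hp.sub_const (f t)).norm ?_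
  filter_upwards [eventually_ge_atTop t] with b htb
  exact hd.norm_sub_le_lengthBound hh he hC ht htb fun s hs => hT s (hTt.trans hs.1)

/-- The multiple `D h` is a barrier for `e`: where the two meet, `e ≤ C (‖f'‖² + h)` forces
`e' ≤ (1 - D / C) h`, and `D h'` is larger because `h' / h` is small. -/
theorem energy_isBigO (hd : IsDissipative f e) (hh : IsDecayRate h)
    (he : ∀ t, 0 < t → h t ≤ e t) (hslow : Tendsto (logDeriv h) atTop (𝓝 0)) (hC : 0 < C)
    (hle : ∀ᶠ t in atTop, e t ≤ C * (‖deriv f t‖ ^ 2 + h t)) : e =O[atTop] h := by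
  have hslow' : ∀ᶠ t in atTop, -(1 / (2 * C)) < logDeriv h t :=
    hslow.eventually_const_lt (neg_lt_zero.2 (by positivity))
  obtain ⟨T, hT⟩ := eventually_atTop.1 (hle.and (hslow'.and (eventually_gt_atTop 0)))
  have hpos (t : ℝ) (ht : T ≤ t) : 0 < t := (hT t ht).2.2
  have hhpos (t : ℝ) (ht : T ≤ t) : 0 < h t := hh.pos t (hpos t ht).le
  set D := max (e T / h T) (2 * C)
  have hD : 2 * C ≤ D := le_max_right _ _
  have hDpos : 0 < D := lt_of_lt_of_le (by positivity) hD
  have hcontact (t : ℝ) (ht : T ≤ t) (heq : e t = D * h t) : deriv e t < D * deriv h t := by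
    obtain ⟨hCe, hlog, ht0⟩ := hT t ht
    have hht := hhpos t ht
    rw [logDeriv_apply, lt_div_iff₀ hht] at hlog
    have hspeed : D * h t / C - h t ≤ ‖deriv f t‖ ^ 2 := by
      rw [sub_le_iff_le_add, div_le_iff₀' hC]
      exact heq ▸ hCe
    have hbarrier : D * (-(1 / (2 * C)) * h t) < D * deriv h t := mul_lt_mul_of_pos_left hlog hDpos
    have hlarge : h t ≤ D / (2 * C) * h t :=
      le_mul_of_one_le_left hht.le ((one_le_div (by positivity)).2 hD)
    have hsplit : D * h t / C = D / (2 * C) * h t - D * (-(1 / (2 * C)) * h t) := by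
      field_simp; ring
    linarith [hd.deriv_energy_le t ht0]
  refine Asymptotics.IsBigO.of_bound D ?_
  filter_upwards [eventually_ge_atTop T] with t ht
  rw [Real.norm_of_nonneg ((hhpos t ht).le.trans (he t (hpos t ht))),
    Real.norm_of_nonneg (hhpos t ht).le]
  exact image_le_of_deriv_right_lt_deriv_boundary'
    (fun s hs => (hd.differentiableAt_energy (hpos s hs.1)).continuousAt.continuousWithinAt)
    (fun s hs => (hd.differentiableAt_energy (hpos s hs.1)).hasDerivAt.hasDerivWithinAt)
    ((div_le_iff₀ (hhpos T le_rfl)).1 (le_max_left _ _))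
    (fun s hs => ((hh.hasDerivAt (hpos s hs.1)).const_mul D).continuousAt.continuousWithinAt)
    (fun s hs => ((hh.hasDerivAt (hpos s hs.1)).const_mul D).hasDerivWithinAt)
    (fun s hs => hcontact s hs.1) (right_mem_Icc.2 ht)

theorem sub_isBigO_sqrtTail (hd : IsDissipative f e) (hh : IsDecayRate h)
    (he : ∀ t, 0 < t → h t ≤ e t) (hslow : Tendsto (logDeriv h) atTop (𝓝 0)) (hC : 0 < C)
    (hp : Tendsto f atTop (𝓝 p)) (hle : ∀ᶠ t in atTop, e t ≤ C * (‖deriv f t‖ ^ 2 + h t)) :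
    (fun t => f t - p) =O[atTop] fun t => sqrtTail h (t - 1) := by
  have hsqrt : (fun t => √(h t)) =O[atTop] fun t => sqrtTail h (t - 1) := by
    refine Asymptotics.IsBigO.of_norm_eventuallyLE ?_
    filter_upwards [eventually_ge_atTop 1] with t ht
    rw [Real.norm_of_nonneg (Real.sqrt_nonneg _)]
    exact hh.sqrt_le_sqrtTail_sub_one ht
  have htail : sqrtTail h =O[atTop] fun t => sqrtTail h (t - 1) := by
    refine Asymptotics.IsBigO.of_norm_eventuallyLE ?_
    filter_upwards [eventually_ge_atTop 1] with t ht
    rw [Real.norm_of_nonneg (sqrtTail_nonneg h t)]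
    exact hh.antitoneOn_sqrtTail (sub_nonneg.2 ht) (zero_le_one.trans ht) (by linarith)
  have henergy : (fun t => √(e t)) =O[atTop] fun t => √(h t) :=
    (hd.energy_isBigO hh he hslow hC hle).sqrt
      ((eventually_ge_atTop 0).mono fun t ht => (hh.pos t ht).le)
  have hlength : (fun t => f t - p) =O[atTop] lengthBound h e C := by
    refine Asymptotics.IsBigO.of_norm_eventuallyLE ?_
    exact hd.eventually_norm_sub_le_lengthBound hh he hC.le hp hle
  exact hlength.trans (htail.add ((henergy.trans hsqrt).const_mul_left _))

end IsDissipative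

end Dissipation

/-! ### Orbits of the perturbed gradient flow -/

section PalaisSmale

variable {H X : Type*} [NormedAddCommGroup H] [NormedAddCommGroup X] {V W : X → ℝ}
  {G K : X → H} {B : Set X}

/-- The Palais–Smale condition on `B`: a sequence in `B` along which `G → 0` has a subsequence that
converges to a point of `B`. -/
def IsPalaisSmaleOn (G : X → H) (B : Set X) : Prop :=
  ∀ v : ℕ → X, (∀ n, v n ∈ B) → Tendsto (fun n => G (v n)) atTop (𝓝 0) →
    ∃ x ∈ B, ∃ φ : ℕ → ℕ, StrictMono φ ∧ Tendsto (fun n => v (φ n)) atTop (𝓝 x)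

theorem isPalaisSmaleOn_of_isCompact (hB : IsCompact B) (G : X → H) : IsPalaisSmaleOn G B :=
  fun _ hv _ => hB.tendsto_subseq hv

theorem IsCoerciveOnBounded.isPalaisSmaleOn (hG : IsCoerciveOnBounded G)
    (hB : Bornology.IsBounded B) (hBc : IsClosed B) : IsPalaisSmaleOn G B := fun v hv hGv => by
  obtain ⟨x, φ, hφ, hx⟩ := hG v (hB.subset (range_subset_iff.2 hv)) hGv
  exact ⟨x, hBc.mem_of_tendsto hx (Eventually.of_forall fun n => hv _), φ, hφ, hx⟩

theorem IsPalaisSmaleOn.exists_subseq_of_eventually_mem (hB : IsPalaisSmaleOn G B) {v : ℕ → X}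
    (hv : ∀ᶠ n in atTop, v n ∈ B) (hGv : Tendsto (fun n => G (v n)) atTop (𝓝 0)) :
    ∃ x ∈ B, ∃ φ : ℕ → ℕ, StrictMono φ ∧ Tendsto (fun n => v (φ n)) atTop (𝓝 x) := by
  obtain ⟨N, hN⟩ := eventually_atTop.1 hv
  obtain ⟨x, hx, φ, hφ, hlim⟩ := hB (fun n => v (n + N)) (fun n => hN _ (Nat.le_add_left N n))
    (hGv.comp (tendsto_add_atTop_nat N))
  exact ⟨x, hx, fun n => φ n + N, fun _ _ hmn => Nat.add_lt_add_right (hφ hmn) N, hlim⟩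

/-- A set `B` of states to which the convergence theory applies: it is bounded, `V`, `W` and the
perturbation `K` are bounded on it, and `G` satisfies the Palais–Smale condition on it. Both
compactness and coercivity lead to such sets. -/
structure IsAdmissibleSet (V W : X → ℝ) (G K : X → H) (B : Set X) : Prop where
  isPalaisSmaleOn : IsPalaisSmaleOn G B
  isBounded : Bornology.IsBounded B
  isBounded_image_potential : Bornology.IsBounded (V '' B)
  isBounded_image_perturbation : Bornology.IsBounded (W '' B)
  isBounded_image_perturbation_gradient : Bornology.IsBounded (K '' B)

theorem isAdmissibleSet_of_isCompact (hB : IsCompact B) (hV : Continuous V) (hW : Continuous W)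
    (hK : Continuous K) (G : X → H) : IsAdmissibleSet V W G K B :=
  ⟨isPalaisSmaleOn_of_isCompact hB G, hB.isBounded, (hB.image hV).isBounded,
    (hB.image hW).isBounded, (hB.image hK).isBounded⟩

theorem IsCoerciveOnBounded.isAdmissibleSet (hG : IsCoerciveOnBounded G)
    (hB : Bornology.IsBounded B) (hBc : IsClosed B) (hV : BoundedOnBounded V)
    (hW : BoundedOnBounded W) (hK : BoundedOnBounded K) : IsAdmissibleSet V W G K B :=
  ⟨hG.isPalaisSmaleOn hB hBc, hB, hV B hB, hW B hB, hK B hB⟩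

namespace IsPalaisSmaleOn

variable [NormedSpace ℝ H] [NormedSpace ℝ X] {j : X →L[ℝ] H} {ψ : X}

/-- On `B`, closeness to `ψ` in the weak sense of `H` improves to closeness in `X` where the
gradient is small. -/
theorem comap_inf_le_nhds (hB : IsPalaisSmaleOn G B) (hj : Function.Injective j) (ψ : X) :
    comap j (𝓝 (j ψ)) ⊓ 𝓟 B ⊓ comap G (𝓝 0) ≤ 𝓝 ψ := by
  refine tendsto_id'.1 (tendsto_of_subseq_tendsto fun v hv => ?_)
  obtain ⟨⟨hjv, hvB⟩, hGv⟩ := by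
    simpa only [tendsto_inf, tendsto_comap_iff, tendsto_principal] using hv
  obtain ⟨x, -, φ, hφ, hx⟩ := hB.exists_subseq_of_eventually_mem hvB hGv
  have hxψ : x = ψ := hj <| tendsto_nhds_unique ((j.continuous.tendsto x).comp hx)
    (hjv.comp hφ.tendsto_atTop)
  exact ⟨φ, hxψ ▸ hx⟩

theorem isBigO_of_isBigO_nhds (hB : IsPalaisSmaleOn G B) (hj : Function.Injective j)
    (hVB : Bornology.IsBounded (V '' B))
    (hloc : (fun x => V x - V ψ) =O[𝓝 ψ] fun x => ‖G x‖ ^ 2) :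
    (fun x => V x - V ψ) =O[comap j (𝓝 (j ψ)) ⊓ 𝓟 B] fun x => ‖G x‖ ^ 2 := by
  obtain ⟨C, hC, hCle⟩ := (hloc.mono (hB.comap_inf_le_nhds hj ψ)).exists_pos
  obtain ⟨S, hS, T, hT, hST⟩ := eventually_inf.1 hCle.bound
  obtain ⟨r, hr, hrT⟩ := Metric.nhds_basis_ball.comap G |>.mem_iff.1 hT
  obtain ⟨M, hM⟩ := hVB.exists_norm_le
  refine Asymptotics.IsBigO.of_bound (max C ((M + |V ψ|) / r ^ 2)) ?_
  filter_upwards [hS, mem_inf_of_right (mem_principal_self B)] with x hxS hxB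
  rcases lt_or_ge ‖G x‖ r with hsmall | hlarge
  · refine (hST x ⟨hxS, hrT (mem_ball_zero_iff.2 hsmall)⟩).trans ?_
    gcongr
    exact le_max_left _ _
  · have : 0 ≤ M := (norm_nonneg _).trans (hM _ (mem_image_of_mem V hxB))
    calc ‖V x - V ψ‖ ≤ M + |V ψ| := (norm_sub_le _ _).trans
          (add_le_add_left (hM _ (mem_image_of_mem V hxB)) _)
      _ = (M + |V ψ|) / r ^ 2 * r ^ 2 := by rw [div_mul_cancel₀ _ (by positivity)]
      _ ≤ max C ((M + |V ψ|) / r ^ 2) * ‖‖G x‖ ^ 2‖ := by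
          rw [Real.norm_of_nonneg (sq_nonneg _)]
          gcongr
          exact le_max_right _ _

theorem not_accPt_image (hB : IsPalaisSmaleOn G B) (hj : Function.Injective j)
    (hψ : ¬ AccPt ψ (𝓟 (equilibria G))) : ¬ AccPt (j ψ) (𝓟 (j '' (B ∩ equilibria G))) := by
  rw [accPt_iff_frequently, not_frequently] at hψ ⊢
  obtain ⟨S, hS, T, hT, hST⟩ := eventually_inf.1 (hψ.filter_mono (hB.comap_inf_le_nhds hj ψ))
  filter_upwards [eventually_comap.1 (eventually_inf_principal.1 hS)] with y hy
  rintro ⟨hyψ, x, ⟨hxB, hx⟩, rfl⟩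
  have hxT : x ∈ T := by
    obtain ⟨N, hN, hNT⟩ := hT
    exact hNT (show G x ∈ N from (show G x = 0 from hx) ▸ mem_of_mem_nhds hN)
  exact hST x ⟨hy x rfl hxB, hxT⟩ ⟨fun h => hyψ (congrArg j h), hx⟩

end IsPalaisSmaleOn

end PalaisSmale

section Energy

variable {X : Type*} {V W : X → ℝ} {h : ℝ → ℝ} {u : ℝ → X} {M : ℝ}

/-- The energy `c - V - h W` of an orbit relative to the level `c` of `V`; the correction `M h`
makes it decrease along the orbit when `W ≤ M`. -/
def orbitEnergy (V W : X → ℝ) (h : ℝ → ℝ) (u : ℝ → X) (c M t : ℝ) : ℝ :=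
  c - V (u t) + h t * (M - W (u t))

theorem orbitEnergy_add_one (c M t : ℝ) :
    orbitEnergy V W h u c (M + 1) t = orbitEnergy V W h u c M t + h t := by
  simp only [orbitEnergy]
  ring

theorem IsDecayRate.tendsto_orbitEnergy_iff (hh : IsDecayRate h)
    (hWb : ∀ t, 0 ≤ t → |W (u t)| ≤ M) (c N l : ℝ) :
    Tendsto (orbitEnergy V W h u c N) atTop (𝓝 (c - l)) ↔
      Tendsto (fun t => V (u t)) atTop (𝓝 l) := by
  have hcorr : Tendsto (fun t => h t * (N - W (u t))) atTop (𝓝 0) :=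
    hh.tendsto_smul (M := |N| + M) fun t ht =>
      (norm_sub_le _ _).trans (add_le_add_right (hWb t ht) _)
  refine ⟨fun he => ?_, fun hV => ?_⟩
  · simpa [orbitEnergy] using (he.sub hcorr).const_sub c
  · have hlim := (hV.const_sub c).add hcorr
    rwa [add_zero] at hlim

end Energy

section Orbits

variable {H X : Type*} [NormedAddCommGroup H] [InnerProductSpace ℝ H]
  [NormedAddCommGroup X] [NormedSpace ℝ X] {j : X →L[ℝ] H} {V W : X → ℝ} {G K : X → H}
  {B : Set X} {ψ : X} {h : ℝ → ℝ} {u : ℝ → X} {c M : ℝ}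

theorem IsGradient.boundedOnBounded (hW : IsGradient j W K) (hK : BoundedOnBounded K) :
    BoundedOnBounded W := fun B hB => by
  obtain ⟨R, hR, hBR⟩ := hB.subset_closedBall_lt 0 0
  obtain ⟨M, hM⟩ := (hK _ (Metric.isBounded_closedBall (x := (0 : X)) (r := R))).exists_norm_le
  refine isBounded_iff_forall_norm_le.2 ⟨|W 0| + M * (‖j‖ * R), ?_⟩
  rintro _ ⟨x, hx, rfl⟩
  obtain ⟨z, hz, hWz⟩ := hW.exists_sub_eq_inner 0 x
  have hzM : ‖K z‖ ≤ M := hM _ <| mem_image_of_mem K <|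
    (convex_closedBall (0 : X) R).segment_subset (Metric.mem_closedBall_self hR.le) (hBR hx) hz
  have hjx : ‖j x‖ ≤ ‖j‖ * R := j.le_opNorm_of_le (mem_closedBall_zero_iff.1 (hBR hx))
  calc ‖W x‖ ≤ |W 0| + |W x - W 0| := by
        simpa using abs_add_le (W 0) (W x - W 0)
    _ ≤ |W 0| + ‖K z‖ * ‖j x‖ := by
        rw [hWz, sub_zero]; gcongr; exact abs_real_inner_le_norm _ _
    _ ≤ |W 0| + M * (‖j‖ * R) := by gcongr; exact (norm_nonneg _).trans hzM

theorem IsOrbit.hasDerivAt_orbitEnergy (hu : IsOrbit j G K h u) (hV : IsGradient j V G)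
    (hG : Continuous G) (hW : IsGradient j W K) (hK : Continuous K) (c M : ℝ) {h' t : ℝ}
    (ht : 0 < t) (hh : HasDerivAt h h' t) :
    HasDerivAt (orbitEnergy V W h u c M)
      (h' * (M - W (u t)) - ‖G (u t) + h t • K (u t)‖ ^ 2) t := by
  have hcont : ContinuousAt u t := hu.continuousOn.continuousAt (Ioi_mem_nhds ht)
  have hVu := hV.hasDerivAt_comp hG hcont (hu.equation t ht)
  have hWu := hW.hasDerivAt_comp hK hcont (hu.equation t ht)
  refine ((hVu.const_sub c).add (hh.mul (hWu.const_sub M))).congr_deriv ?_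
  have hsq : ‖G (u t) + h t • K (u t)‖ ^ 2 = inner ℝ (G (u t)) (G (u t) + h t • K (u t)) +
      h t * inner ℝ (K (u t)) (G (u t) + h t • K (u t)) := by
    rw [← real_inner_self_eq_norm_sq, inner_add_left, real_inner_smul_left]
  rw [hsq]
  ring

theorem IsOrbit.isDissipative (hu : IsOrbit j G K h u) (hh : IsDecayRate h)
    (hV : IsGradient j V G) (hG : Continuous G) (hW : IsGradient j W K) (hK : Continuous K)
    (hWM : ∀ t, 0 ≤ t → W (u t) ≤ M) (c : ℝ) :
    IsDissipative (fun t => j (u t)) (orbitEnergy V W h u c M) := by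
  have henergy (t : ℝ) (ht : 0 < t) :=
    hu.hasDerivAt_orbitEnergy hV hG hW hK c M ht (hh.hasDerivAt ht)
  refine ⟨fun t ht => (hu.equation t ht).differentiableAt.differentiableWithinAt,
    fun t ht => (henergy t ht).differentiableAt.differentiableWithinAt, fun t ht => ?_⟩
  rw [(henergy t ht).deriv, (hu.equation t ht).deriv]
  linarith [mul_nonpos_of_nonpos_of_nonneg (hh.deriv_nonpos ht) (sub_nonneg.2 (hWM t ht.le))]

theorem IsOrbit.exists_tendsto_potential (hu : IsOrbit j G K h u) (hh : IsDecayRate h)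
    (hV : IsGradient j V G) (hG : Continuous G) (hW : IsGradient j W K) (hK : Continuous K)
    {N : ℝ} (hVb : ∀ t, 0 ≤ t → V (u t) ≤ N) (hWb : ∀ t, 0 ≤ t → |W (u t)| ≤ M) :
    ∃ c, Tendsto (fun t => V (u t)) atTop (𝓝 c) := by
  have hWM (t : ℝ) (ht : 0 ≤ t) : W (u t) ≤ M := (le_abs_self _).trans (hWb t ht)
  obtain ⟨l, hl⟩ := (hu.isDissipative hh hV hG hW hK hWM 0).exists_tendsto_energy (m := -N)
    fun t ht => by
      have := mul_nonneg (hh.pos t ht.le).le (sub_nonneg.2 (hWM t ht.le))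
      simp only [orbitEnergy]
      linarith [hVb t ht.le]
  exact ⟨-l, (hh.tendsto_orbitEnergy_iff hWb 0 M (-l)).1 (by simpa using hl)⟩

theorem IsOrbit.isSeqAttractedTo (hu : IsOrbit j G K h u) (hh : IsDecayRate h)
    (hG : Continuous G) (hV : Continuous V) {e : ℝ → ℝ} {l : ℝ}
    (hd : IsDissipative (fun t => j (u t)) e) (he : Tendsto e atTop (𝓝 l))
    (hB : IsPalaisSmaleOn G B) (huB : ∀ t, 0 ≤ t → u t ∈ B) (hKb : ∀ t, 0 ≤ t → ‖K (u t)‖ ≤ M)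
    (hc : Tendsto (fun t => V (u t)) atTop (𝓝 c)) :
    IsSeqAttractedTo (fun t => j (u t)) (j '' (B ∩ equilibria G ∩ V ⁻¹' {c})) := by
  obtain ⟨τ, hτ, hspeed, hshift⟩ := hd.exists_shift he
  have hτ' : Tendsto τ atTop atTop := tendsto_atTop_mono hτ tendsto_id
  have hgrad : Tendsto (fun t => G (u (τ t))) atTop (𝓝 0) := by
    have hlim := hspeed.sub ((hh.tendsto_smul hKb).comp hτ')
    rw [sub_zero] at hlim
    refine hlim.congr' ?_
    filter_upwards [hτ'.eventually_gt_atTop 0] with t ht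
    simp [(hu.equation _ ht).deriv]
  intro s hs
  have hmem : ∀ᶠ n in atTop, u (τ (s n)) ∈ B :=
    ((hτ'.comp hs).eventually_ge_atTop 0).mono fun n => huB _
  obtain ⟨x, hxB, φ, hφ, hx⟩ := hB.exists_subseq_of_eventually_mem hmem (hgrad.comp hs)
  have hsφ : Tendsto (fun n => s (φ n)) atTop atTop := hs.comp hφ.tendsto_atTop
  have hGx : G x = 0 := tendsto_nhds_unique ((hG.tendsto x).comp hx) (hgrad.comp hsφ)
  have hVx : V x = c := tendsto_nhds_unique ((hV.tendsto x).comp hx) ((hc.comp hτ').comp hsφ)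
  refine ⟨j x, mem_image_of_mem j ⟨⟨hxB, hGx⟩, hVx⟩, φ, hφ, ?_⟩
  simpa using ((j.continuous.tendsto x).comp hx).sub (hshift.comp hsφ)

theorem norm_sq_le_two_mul_norm_add_smul_sq {g k : H} {η η₀ : ℝ} (hη : 0 ≤ η) (hη₀ : η ≤ η₀)
    (hk : ‖k‖ ≤ M) : ‖g‖ ^ 2 ≤ 2 * (‖g + η • k‖ ^ 2 + η₀ * M ^ 2 * η) := by
  have hη₀_nonneg : 0 ≤ η₀ := hη.trans hη₀
  have hsmul : ‖η • k‖ ^ 2 ≤ η₀ * M ^ 2 * η := by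
    rw [norm_smul, mul_pow, Real.norm_of_nonneg hη]
    calc η ^ 2 * ‖k‖ ^ 2 ≤ (η₀ * η) * M ^ 2 := by rw [sq η]; gcongr
      _ = η₀ * M ^ 2 * η := by ring
  calc ‖g‖ ^ 2 = ‖(g + η • k) - η • k‖ ^ 2 := by rw [add_sub_cancel_right]
    _ ≤ (‖g + η • k‖ + ‖η • k‖) ^ 2 := by gcongr; exact norm_sub_le _ _
    _ ≤ 2 * (‖g + η • k‖ ^ 2 + ‖η • k‖ ^ 2) := add_sq_le
    _ ≤ 2 * (‖g + η • k‖ ^ 2 + η₀ * M ^ 2 * η) := by gcongr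

theorem IsOrbit.exists_orbitEnergy_le (hu : IsOrbit j G K h u) (hh : IsDecayRate h)
    (huB : ∀ t, 0 ≤ t → u t ∈ B) {L : ℝ} (hWb : ∀ t, 0 ≤ t → |W (u t)| ≤ M)
    (hKb : ∀ t, 0 ≤ t → ‖K (u t)‖ ≤ L) (N : ℝ)
    (hloj : (fun x => V x - V ψ) =O[comap j (𝓝 (j ψ)) ⊓ 𝓟 B] fun x => ‖G x‖ ^ 2) :
    ∃ C > 0, ∃ U ∈ 𝓝 (j ψ), ∀ t, 0 < t → j (u t) ∈ U → orbitEnergy V W h u (V ψ) N t ≤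
      C * (‖deriv (fun s => j (u s)) t‖ ^ 2 + h t) := by
  obtain ⟨C, hC, hCV⟩ := hloj.exists_pos
  have hU := eventually_comap.1 (eventually_inf_principal.1 hCV.bound)
  have hM : 0 ≤ M := (abs_nonneg _).trans (hWb 0 le_rfl)
  have hh0 : 0 < h 0 := hh.pos 0 le_rfl
  refine ⟨2 * C + 2 * C * (h 0 * L ^ 2) + (|N| + M), by positivity, _, hU, fun t ht hut => ?_⟩
  have hht : 0 < h t := hh.pos t ht.le
  have hVt : V ψ - V (u t) ≤ C * ‖G (u t)‖ ^ 2 := by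
    have hbound := hut (u t) rfl (huB t ht.le)
    rw [Real.norm_of_nonneg (sq_nonneg _), norm_sub_rev] at hbound
    exact (Real.le_norm_self _).trans hbound
  have hGt := norm_sq_le_two_mul_norm_add_smul_sq (g := G (u t)) hht.le
    (hh.antitoneOn self_mem_Ici ht.le ht.le) (hKb t ht.le)
  have hWt : N - W (u t) ≤ |N| + M := by
    linarith [le_abs_self N, neg_abs_le (W (u t)), hWb t ht.le]
  rw [(hu.equation t ht).deriv]
  set v := G (u t) + h t • K (u t)
  calc orbitEnergy V W h u (V ψ) N t
      ≤ C * (2 * (‖v‖ ^ 2 + h 0 * L ^ 2 * h t)) + h t * (|N| + M) := by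
        rw [orbitEnergy]; gcongr; exact hVt.trans (by gcongr)
    _ ≤ C * (2 * (‖v‖ ^ 2 + h 0 * L ^ 2 * h t)) + h t * (|N| + M) +
        (2 * C * h t + (2 * C * (h 0 * L ^ 2) + (|N| + M)) * ‖v‖ ^ 2) :=
        le_add_of_nonneg_right (by positivity)
    _ = _ := by ring

theorem omegaLimitSet_eq_singleton {y : H} (hy : Tendsto (fun t => j (u t)) atTop (𝓝 y)) :
    omegaLimitSet j u = {y} := by
  refine Subset.antisymm (fun z ⟨s, hs, hz⟩ => tendsto_nhds_unique hz (hy.comp hs)) ?_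
  rintro _ rfl
  exact ⟨fun n => n, tendsto_natCast_atTop_atTop, hy.comp tendsto_natCast_atTop_atTop⟩

theorem ResonanceHypothesis.ker_eq_bot_or_isLocalManifoldAt (hR : ResonanceHypothesis G)
    [FiniteDimensional ℝ (fderiv ℝ G ψ).ker]
    (hψ : IsBranchingPoint G ψ ∨ (fderiv ℝ G ψ).ker = ⊥) :
    (fderiv ℝ G ψ).ker = ⊥ ∨
      IsLocalManifoldAt (Module.finrank ℝ (fderiv ℝ G ψ).ker) (equilibria G) ψ := by
  refine or_iff_not_imp_left.2 fun hker => hR ψ (hψ.resolve_right hker) ?_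
  exact Submodule.one_le_finrank_iff.2 hker

theorem IsOrbit.exists_isSeqAttractedTo (hu : IsOrbit j G K h u) (hh : IsDecayRate h)
    (hV : IsGradient j V G) (hG : Continuous G) (hW : IsGradient j W K) (hK : Continuous K)
    (hB : IsAdmissibleSet V W G K B) (huB : ∀ t, 0 ≤ t → u t ∈ B) :
    ∃ c, Tendsto (fun t => V (u t)) atTop (𝓝 c) ∧
      IsSeqAttractedTo (fun t => j (u t)) (j '' (B ∩ equilibria G ∩ V ⁻¹' {c})) := by
  obtain ⟨N, hN⟩ := hB.isBounded_image_potential.exists_norm_le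
  obtain ⟨M, hM⟩ := hB.isBounded_image_perturbation.exists_norm_le
  obtain ⟨L, hL⟩ := hB.isBounded_image_perturbation_gradient.exists_norm_le
  have hWb (t : ℝ) (ht : 0 ≤ t) : |W (u t)| ≤ M := hM _ (mem_image_of_mem W (huB t ht))
  obtain ⟨c, hc⟩ := hu.exists_tendsto_potential hh hV hG hW hK
    (fun t ht => (Real.le_norm_self _).trans (hN _ (mem_image_of_mem V (huB t ht)))) hWb
  have hd := hu.isDissipative hh hV hG hW hK (fun t ht => (le_abs_self _).trans (hWb t ht)) c
  have he := (hh.tendsto_orbitEnergy_iff hWb c M c).2 hc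
  exact ⟨c, hc, hu.isSeqAttractedTo hh hG hV.continuous hd he hB.isPalaisSmaleOn huB
    (fun t ht => hL _ (mem_image_of_mem K (huB t ht))) hc⟩

/-- Raising the constant `M` of `orbitEnergy` by one makes the energy at least `h`. -/
theorem IsOrbit.exists_isDissipative (hu : IsOrbit j G K h u) (hh : IsDecayRate h)
    (hV : IsGradient j V G) (hG : Continuous G) (hW : IsGradient j W K) (hK : Continuous K)
    (hB : IsAdmissibleSet V W G K B) (huB : ∀ t, 0 ≤ t → u t ∈ B) (hj : Function.Injective j)
    (hVψ : Tendsto (fun t => V (u t)) atTop (𝓝 (V ψ)))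
    (hloj : (fun x => V x - V ψ) =O[𝓝 ψ] fun x => ‖G x‖ ^ 2) :
    ∃ e, IsDissipative (fun t => j (u t)) e ∧ (∀ t, 0 < t → h t ≤ e t) ∧
      Tendsto e atTop (𝓝 0) ∧ ∃ C > 0, ∃ U ∈ 𝓝 (j ψ), ∀ t, 0 < t → j (u t) ∈ U →
        e t ≤ C * (‖deriv (fun s => j (u s)) t‖ ^ 2 + h t) := by
  obtain ⟨M, hM⟩ := hB.isBounded_image_perturbation.exists_norm_le
  obtain ⟨L, hL⟩ := hB.isBounded_image_perturbation_gradient.exists_norm_le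
  have hWb (t : ℝ) (ht : 0 ≤ t) : |W (u t)| ≤ M := hM _ (mem_image_of_mem W (huB t ht))
  have hWM (t : ℝ) (ht : 0 ≤ t) : W (u t) ≤ M := (le_abs_self _).trans (hWb t ht)
  have hlim (N : ℝ) : Tendsto (orbitEnergy V W h u (V ψ) N) atTop (𝓝 0) :=
    sub_self (V ψ) ▸ (hh.tendsto_orbitEnergy_iff hWb (V ψ) N (V ψ)).2 hVψ
  refine ⟨orbitEnergy V W h u (V ψ) (M + 1), hu.isDissipative hh hV hG hW hK
    (fun t ht => (hWM t ht).trans (le_add_of_nonneg_right zero_le_one)) _, fun t ht => ?_,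
    hlim _, ?_⟩
  · rw [orbitEnergy_add_one]
    exact le_add_of_nonneg_left <|
      (hu.isDissipative hh hV hG hW hK hWM _).le_energy_of_tendsto (hlim M) ht
  · exact hu.exists_orbitEnergy_le hh huB hWb
      (fun t ht => hL _ (mem_image_of_mem K (huB t ht))) _
      (hB.isPalaisSmaleOn.isBigO_of_isBigO_nhds hj hB.isBounded_image_potential hloj)

theorem IsOrbit.tendsto_of_isBigO (hu : IsOrbit j G K h u) (hh : IsDecayRate h)
    (hV : IsGradient j V G) (hG : Continuous G) (hW : IsGradient j W K) (hK : Continuous K)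
    (hB : IsAdmissibleSet V W G K B) (huB : ∀ t, 0 ≤ t → u t ∈ B) (hj : Function.Injective j)
    (hVψ : Tendsto (fun t => V (u t)) atTop (𝓝 (V ψ)))
    (hψ : MapClusterPt (j ψ) atTop fun t => j (u t))
    (hloj : (fun x => V x - V ψ) =O[𝓝 ψ] fun x => ‖G x‖ ^ 2) :
    Tendsto (fun t => j (u t)) atTop (𝓝 (j ψ)) := by
  obtain ⟨e, hd, he, he0, C, hC, U, hU, hle⟩ :=
    hu.exists_isDissipative hh hV hG hW hK hB huB hj hVψ hloj
  exact hd.tendsto_of_mapClusterPt hh he he0 hC.le hψ hU hle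

theorem IsOrbit.exists_norm_sub_le (hu : IsOrbit j G K h u) (hh : IsDecayRate h)
    (hslow : Tendsto (logDeriv h) atTop (𝓝 0)) (hV : IsGradient j V G) (hG : Continuous G)
    (hW : IsGradient j W K) (hK : Continuous K) (hB : IsAdmissibleSet V W G K B)
    (huB : ∀ t, 0 ≤ t → u t ∈ B) (hj : Function.Injective j)
    (hVψ : Tendsto (fun t => V (u t)) atTop (𝓝 (V ψ)))
    (hψ : Tendsto (fun t => j (u t)) atTop (𝓝 (j ψ)))
    (hloj : (fun x => V x - V ψ) =O[𝓝 ψ] fun x => ‖G x‖ ^ 2) :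
    ∃ C, ∀ t, 1 ≤ t → ‖j (u t) - j ψ‖ ≤ C * sqrtTail h (t - 1) := by
  obtain ⟨e, hd, he, -, C, hC, U, hU, hle⟩ :=
    hu.exists_isDissipative hh hV hG hW hK hB huB hj hVψ hloj
  have hle' : ∀ᶠ t in atTop, e t ≤ C * (‖deriv (fun s => j (u s)) t‖ ^ 2 + h t) := by
    filter_upwards [hψ hU, eventually_gt_atTop 0] with t htU ht using hle t ht htU
  obtain ⟨R, hR⟩ := hB.isBounded.exists_norm_le
  refine hh.exists_le_mul_sqrtTail (M := ‖j‖ * R + ‖j ψ‖) (fun t ht => ?_)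
    (hd.sub_isBigO_sqrtTail hh he hslow hC hψ hle')
  exact (norm_sub_le _ _).trans <|
    add_le_add_left (j.le_opNorm_of_le (hR _ (huB t (zero_le_one.trans ht)))) _

end Orbits

end PerturbedGradient

open PerturbedGradient in
theorem mainTheorem3_general {H X : Type*}
    [NormedAddCommGroup H] [InnerProductSpace ℝ H] [CompleteSpace H]
    [NormedAddCommGroup X] [NormedSpace ℝ X] [CompleteSpace X]
    {j : X →L[ℝ] H} (hj : Function.Injective j) {V W : X → ℝ} {V' W' : X → H}
    (hV : IsGradient j V V') (hV' : ContDiff ℝ 1 V')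
    (hW : IsGradient j W W') (hW' : Continuous W')
    (hfin : ∀ ψ ∈ equilibria V', FiniteDimensional ℝ (fderiv ℝ V' ψ).ker)
    (hrange : ∀ ψ ∈ equilibria V', IsClosed ((fderiv ℝ V' ψ).range : Set H))
    (hR : ResonanceHypothesis V') {h : ℝ → ℝ} (hh : IsDecayRate h) {u : ℝ → X}
    (hu : IsOrbit j V' W' h u)
    (hbdd : IsCompact (closure (u '' Ici 0)) ∨
      (Bornology.IsBounded (u '' Ici 0) ∧ IsCoerciveOnBounded V' ∧
        BoundedOnBounded V ∧ BoundedOnBounded W')) :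
    omegaLimitSet j u ⊆ j '' equilibria V' ∧
    ∃ ψ ∈ equilibria V', omegaLimitSet j u = {j ψ} ∧
      Tendsto (fun t => j (u t)) atTop (𝓝 (j ψ)) ∧
      (Tendsto (logDeriv h) atTop (𝓝 0) →
        (IsBranchingPoint V' ψ ∨ (fderiv ℝ V' ψ).ker = ⊥) →
        ∃ C : ℝ, ∀ t : ℝ, 1 ≤ t →
          ‖j (u t) - j ψ‖ ≤ C * ∫ s in Ioi (t - 1), Real.sqrt (h s)) := by
  have hG := hV'.continuous
  have huB (t : ℝ) (ht : 0 ≤ t) : u t ∈ closure (u '' Ici 0) :=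
    subset_closure (mem_image_of_mem u ht)
  have hB : IsAdmissibleSet V W V' W' (closure (u '' Ici 0)) := by
    rcases hbdd with hcpt | ⟨hb, hcoer, hVb, hKb⟩
    · exact isAdmissibleSet_of_isCompact hcpt hV.continuous hW.continuous hW' V'
    · exact hcoer.isAdmissibleSet hb.closure isClosed_closure hVb (hW.boundedOnBounded hKb) hKb
  obtain ⟨c, hc, hattr⟩ := hu.exists_isSeqAttractedTo hh hV hG hW hW' hB huB
  obtain ⟨_, ⟨ψ, ⟨⟨-, hψ⟩, rfl⟩, rfl⟩, hcluster⟩ := hattr.exists_mapClusterPt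
  have hloj (hcase : IsBranchingPoint V' ψ ∨ (fderiv ℝ V' ψ).ker = ⊥) :
      (fun x => V x - V ψ) =O[𝓝 ψ] fun x => ‖V' x‖ ^ 2 :=
    have := hfin ψ hψ
    hV.lojasiewicz hψ (hV'.contDiffAt.hasStrictFDerivAt one_ne_zero) (hrange ψ hψ)
      (hR.ker_eq_bot_or_isLocalManifoldAt hcase)
  have hlim : Tendsto (fun t => j (u t)) atTop (𝓝 (j ψ)) := by
    by_cases hacc : AccPt ψ (𝓟 (equilibria V'))
    · exact hu.tendsto_of_isBigO hh hV hG hW hW' hB huB hj hc hcluster (hloj (.inl ⟨hψ, hacc⟩))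
    · refine hattr.tendsto_of_not_accPt hu.continuousOn_zero hcluster fun hacc' => ?_
      exact hB.isPalaisSmaleOn.not_accPt_image hj hacc <|
        hacc'.mono <| principal_mono.2 <| image_mono inter_subset_left
  refine ⟨fun y ⟨s, hs, hy⟩ => ?_, ψ, hψ, omegaLimitSet_eq_singleton hlim, hlim,
    fun hslow hcase => hu.exists_norm_sub_le hh hslow hV hG hW hW' hB huB hj hc hlim (hloj hcase)⟩
  exact image_mono (inter_subset_left.trans inter_subset_right) (hattr.mem_of_tendsto hs hy)

open PerturbedGradient in
theorem mainTheorem3 {H X : Type*}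
    [NormedAddCommGroup H] [InnerProductSpace ℝ H] [CompleteSpace H]
    [NormedAddCommGroup X] [NormedSpace ℝ X] [CompleteSpace X]
    (j : X →L[ℝ] H) (hj_inj : Function.Injective j) (hj_dense : DenseRange j)
    (hj_compact : IsCompactOperator j)
    (V W : X → ℝ) (V' W' : X → H)
    (hV : IsGradient j V V') (hV' : ContDiff ℝ 1 V')
    (hW : IsGradient j W W') (hW' : Continuous W')
    (hFred : ∀ ψ ∈ equilibria V', IsFredholmIndexZero (fderiv ℝ V' ψ))
    (hR : ResonanceHypothesis V') :
    (∀ α : ℝ, 2 < α → IsSlowDecay (fun t => (1 + t) ^ (-α))) ∧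
    ∀ h : ℝ → ℝ, IsSlowDecay h → ∀ u : ℝ → X, IsOrbit j V' W' h u →
      (IsCompact (closure (u '' Ici 0)) ∨
        (Bornology.IsBounded (u '' Ici 0) ∧ IsCoerciveOnBounded V' ∧
          BoundedOnBounded V ∧ BoundedOnBounded W')) →
      omegaLimitSet j u ⊆ j '' equilibria V' ∧
      ∃ ψ ∈ equilibria V', omegaLimitSet j u = {j ψ} ∧
        Tendsto (fun t => j (u t)) atTop (𝓝 (j ψ)) ∧
        ((IsBranchingPoint V' ψ ∨ (fderiv ℝ V' ψ).ker = ⊥) →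
          ∃ C : ℝ, ∀ t : ℝ, 1 ≤ t →
            ‖j (u t) - j ψ‖ ≤ C * ∫ s in Ioi (t - 1), Real.sqrt (h s)) := by
  refine ⟨fun α hα => isSlowDecay_rpow hα, fun h hh u hu hbdd => ?_⟩
  obtain ⟨homega, ψ, hψ, hsingle, hlim, hrate⟩ := mainTheorem3_general hj_inj hV hV' hW hW'
    (fun ψ hψ => (hFred ψ hψ).1.finite_ker) (fun ψ hψ => (hFred ψ hψ).1.isClosed_range) hR
    hh.isDecayRate hu hbdd
  exact ⟨homega, ψ, hψ, hsingle, hlim, hrate hh.tendsto_logDeriv⟩
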